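/- **Setting.** Let $X,Y$ be complex Hilbert spaces, $X$ compactly and densely embedded in $Y$; $(\cdot,\cdot)$ is the inner product of $Y$, linear in the first argument. Let $D_t=\partial/\partial t$ be the weak derivative. $\mathcal X(a,b)$ is the space of $u\in L^2((a,b);X)$ with $D_tu\in L^2((a,b);Y)$, with its natural norm; $\mathcal Y(a,b)=L^2((a,b);Y)$; $\mathcal X_{\rm loc}$, $\mathcal Y_{\rm loc}$ are the corresponding local spaces on $\mathbb R$, and $\widehat{\mathcal X},\widehat{\mathcal Y}$ their subspaces of $1$-periodic functions, with $(f,g)_{\widehat{\mathcal Y}}=\int_0^1(f(t),g(t))\,dt$. Let $A(t):X\to Y$, $t\in\mathbb R$, be bounded operators, continuous in $t$ in the operator norm and $1$-periodic, and put $\mathcal L=D_t+A(t)$, $\mathcal A(\lambda)=\mathcal L+\lambda:\widehat{\mathcal X}\to\widehat{\mathcal Y}$, $\lambda\in\mathbb C$. Assume that $\|u;\mathcal X(0,1)\|\le C(\|\mathcal Lu;\mathcal Y(-1,2)\|+\|u;\mathcal Y(-1,2)\|)$ for all $u\in\mathcal X(-1,2)$, and that $\mathcal A(\lambda_0)$ is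 an isomorphism for some $\lambda_0$. Let $\beta_1<\beta_2$ be such that there is no eigenvalue of $\mathcal A$ with $\Re\lambda\in\{\beta_1,\beta_2\}$, $\Im\lambda\in[0,2\pi)$, and let $\lambda_1,\dots,\lambda_N$ be the distinct eigenvalues with $\beta_1<\Re\lambda<\beta_2$, $\Im\lambda\in[0,2\pi)$. For each $k$ let $\varphi^k_{j,m}\in\widehat{\mathcal X}$, $j=1,\dots,J_k$, $m=0,\dots,m_{k,j}-1$, be a canonical system of Jordan chains of $\mathcal A$ at $\lambda_k$; in particular $\mathcal A(\lambda_k)\varphi^k_{j,0}=0$ and $\mathcal A(\lambda_k)\varphi^k_{j,m}=-\varphi^k_{j,m-1}$. Let $\psi^k_{j,m}\in\widehat{\mathcal Y}$ (same indices) be the Jordan chains of the adjoint pencil, $\mathcal A(\lambda_k)^*\psi^k_{j,0}=0$, $\mathcal A(\lambda_k)^*\psi^k_{j,m}=-\psi^k_{j,m-1}$, where $\mathcal A(\lambda)^*=-D_t+A(t)^*+\overline\lambda$ is the adjoint with respect to $(\cdot,\cdot)_{\widehat{\mathcal Y}}$, normalized by $$(\varphi^k_{j,m_{k,j}-1},\psi^k_{J,m})_{\widehat{\mathcal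 Y}}=\delta^J_j\delta^m_0,\qquad m=0,\dots,m_{k,J}-1.$$ **Pointwise values.** For $t\in\mathbb R$, the value $u(t)\in Y$ of $u\in\mathcal X_{\rm loc}$ is the limit in $Y$ of the means of $u$ over $(t-h,t+h)$ as $h\to0+$, and for $y\in Y$ the number $(y,\psi^k_{j,m}(t))$ is the limit of $(y,\psi_h)$, where $\psi_h$ is the mean of $\psi^k_{j,m}$ over $(t-h,t+h)$. Let $$\mathcal P(t)y=\sum_{k=1}^N\sum_{j=1}^{J_k}\sum_{m=0}^{m_{k,j}-1}(y,\psi^k_{j,m}(t))\,\varphi^k_{j,m_{k,j}-1-m}(t),$$ with domain $D(t)\subseteq Y$ the set of all $y$ for which these limits exist, and put $(\mathcal Pu)(t)=\mathcal P(t)u(t)$, $u^k_{j,m}(t)=(u(t),\psi^k_{j,m}(t))$, $u^k_{j,-1}=0$. **Theorem.** For almost every $t$, $(y,\psi^k_{j,m}(t))$ exists for all $y\in Y$ and all indices, and is the inner product of $Y$. Every $u\in\mathcal X_{\rm loc}$ has a value $u(t)\in D(t)$ at every $t$, which is continuous in $t$ as an element of $Y$ and equals $u$ almost everywhere. For all $t\in\mathbb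 R$ and all indices $$(\varphi^k_{j,m_{k,j}-1-m}(t),\psi^K_{J,M}(t))=\delta^k_K\delta^j_J\delta^m_M .$$ Moreover: (i) for every $t\in\mathbb R$, $\mathcal P(t)$ is a projector: it maps $D(t)$ into itself and $\mathcal P(t)^2=\mathcal P(t)$ on $D(t)$; $D(t)$ contains $X$. For almost every $t$, and for every $t$ at which the means of all $\psi^k_{j,m}$ over $(t-h,t+h)$ are bounded in $Y$ as $h\to0+$, $D(t)=Y$ and $\mathcal P(t)$ is bounded in $Y$. (ii) $\mathcal L\mathcal Pu=\mathcal P\mathcal Lu$ for all $u\in\mathcal X_{\rm loc}$. (iii) for all $u\in\mathcal X_{\rm loc}$ the functions $u^k_{j,m}$ are continuous with weak derivatives in $L^1_{\rm loc}(\mathbb R)$, and $$\mathcal L\mathcal Pu=\sum_{k=1}^N\sum_{j=1}^{J_k}\sum_{m=0}^{m_{k,j}-1}\big((D_t-\lambda_k)u^k_{j,m}-u^k_{j,m-1}\big)\varphi^k_{j,m_{k,j}-1-m}.$$ Here (ii) and (iii) hold almost everywhere, with $\mathcal Pu\in L^2_{\rm loc}(\mathbb R;X)$ having its weak derivative in $L^1_{\rm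 loc}(\mathbb R;Y)$. -/

import Mathlib

open MeasureTheory Filter Topology Set
open scoped ContDiff

noncomputable section

namespace Floquet

/-! ### Weak derivatives and function spaces -/

section Weak

variable {E : Type*} [NormedAddCommGroup E] [NormedSpace ℝ E]

/-- `g` is the weak derivative `D_t f` of `f` on the open set `Ω ⊆ ℝ`; both functions are locally
(Bochner) integrable in `Ω`. -/
def IsWeakDerivOn (Ω : Set ℝ) (f g : ℝ → E) : Prop :=
  LocallyIntegrableOn f Ω ∧ LocallyIntegrableOn g Ω ∧
    ∀ η : ℝ → ℝ, ContDiff ℝ ∞ η → HasCompactSupport η → tsupport η ⊆ Ω →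
      ∫ t, deriv η t • f t = - ∫ t, η t • g t

/-- `f ∈ L²_loc(ℝ; E)`. -/
def MemL2Loc (f : ℝ → E) : Prop :=
  ∀ a b : ℝ, MemLp f 2 (volume.restrict (Ioo a b))

/-- The mean value of `f` over `(t - h, t + h)`. -/
def mean (f : ℝ → E) (h t : ℝ) : E :=
  (2 * h)⁻¹ • ∫ s in (t - h)..(t + h), f s

/-- `f` has the value `e` at the point `t`, in the sense of Lebesgue: the means of `f` over
`(t - h, t + h)` tend to `e`. This does not depend on the representative of `f`, and gives the
value of the continuous representative wherever there is one. -/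
def HasValueAt (f : ℝ → E) (t : ℝ) (e : E) : Prop :=
  Tendsto (fun h => mean f h t) (𝓝[>] 0) (𝓝 e)

/-- The value of `f` at the point `t`; meaningful if `HasValueAt f t e` for some `e`. -/
def valueAt (f : ℝ → E) (t : ℝ) : E :=
  limUnder (𝓝[>] 0) (fun h => mean f h t)

/-- The norm of `L²((a, b); E)`. -/
def normY (a b : ℝ) (f : ℝ → E) : ℝ :=
  Real.sqrt (∫ t in a..b, ‖f t‖ ^ 2)

end Weak

variable {X Y : Type*} [NormedAddCommGroup X] [InnerProductSpace ℂ X]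
  [NormedAddCommGroup Y] [InnerProductSpace ℂ Y]

/-- `u ∈ 𝒳(a, b)` with weak derivative `D_t u = u'`. -/
def MemX (ι : X →L[ℂ] Y) (a b : ℝ) (u : ℝ → X) (u' : ℝ → Y) : Prop :=
  MemLp u 2 (volume.restrict (Ioo a b)) ∧ MemLp u' 2 (volume.restrict (Ioo a b)) ∧
    IsWeakDerivOn (Ioo a b) (fun t => ι (u t)) u'

/-- The norm of `𝒳(a, b)`. -/
def normX (a b : ℝ) (u : ℝ → X) (u' : ℝ → Y) : ℝ :=
  Real.sqrt (∫ t in a..b, (‖u t‖ ^ 2 + ‖u' t‖ ^ 2))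

/-- `u ∈ 𝒳_loc` with weak derivative `D_t u = u'`. -/
def MemXLoc (ι : X →L[ℂ] Y) (u : ℝ → X) (u' : ℝ → Y) : Prop :=
  ∀ a b : ℝ, a < b → MemX ι a b u u'

/-- `u` belongs to the space of `1`-periodic elements of `𝒳_loc`, and `D_t u = u'`. -/
def MemXPer (ι : X →L[ℂ] Y) (u : ℝ → X) (u' : ℝ → Y) : Prop :=
  MemXLoc ι u u' ∧ Function.Periodic u 1

/-- `f` belongs to the space of `1`-periodic elements of `L²_loc(ℝ; Y)`. -/
def MemYPer (f : ℝ → Y) : Prop :=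
  MemL2Loc f ∧ Function.Periodic f 1

/-- The inner product `∫₀¹ (f(t), g(t)) dt`, linear in `f`. -/
def innerPer (f g : ℝ → Y) : ℂ :=
  ∫ t in (0 : ℝ)..1, inner ℂ (g t) (f t)

/-! ### The operator `𝓛 = D_t + A(t)` and the pencil `𝒜(λ) = 𝓛 + λ` -/

/-- `𝓛 u = f` almost everywhere, where `u ∈ L²_loc(ℝ; X)` has a weak derivative in
`L¹_loc(ℝ; Y)`. -/
def LEq (ι : X →L[ℂ] Y) (A : ℝ → X →L[ℂ] Y) (u : ℝ → X) (f : ℝ → Y) : Prop :=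
  MemL2Loc u ∧ ∃ u' : ℝ → Y, IsWeakDerivOn univ (fun t => ι (u t)) u' ∧
    ∀ᵐ t, u' t + A t (u t) = f t

/-- The local estimate
`‖u; 𝒳(0,1)‖ ≤ C (‖𝓛u; L²((-1,2);Y)‖ + ‖u; L²((-1,2);Y)‖)` on `𝒳(-1,2)`. -/
def LocalEstimate (ι : X →L[ℂ] Y) (A : ℝ → X →L[ℂ] Y) : Prop :=
  ∃ C : ℝ, ∀ (u : ℝ → X) (u' : ℝ → Y), MemX ι (-1) 2 u u' →
    normX 0 1 u u' ≤
      C * (normY (-1) 2 (fun t => u' t + A t (u t)) + normY (-1) 2 (fun t => ι (u t)))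

/-- `u` is a `1`-periodic element of `𝒳_loc` and `𝒜(z) u = f` almost everywhere. -/
def PencilEq (ι : X →L[ℂ] Y) (A : ℝ → X →L[ℂ] Y) (z : ℂ) (u : ℝ → X) (f : ℝ → Y) : Prop :=
  ∃ u' : ℝ → Y, MemXPer ι u u' ∧ ∀ᵐ t, u' t + A t (u t) + z • ι (u t) = f t

/-- `𝒜(z)` is an isomorphism between the periodic spaces, i.e. a bijection modulo equality almost
everywhere (the inverse is then bounded by the open mapping theorem). -/
def PencilIso (ι : X →L[ℂ] Y) (A : ℝ → X →L[ℂ] Y) (z : ℂ) : Prop :=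
  (∀ f : ℝ → Y, MemYPer f → ∃ u, PencilEq ι A z u f) ∧
    ∀ u, PencilEq ι A z u 0 → u =ᵐ[volume] 0

/-- `z` is an eigenvalue of the pencil `𝒜`. -/
def IsEigenvalue (ι : X →L[ℂ] Y) (A : ℝ → X →L[ℂ] Y) (z : ℂ) : Prop :=
  ∃ u, PencilEq ι A z u 0 ∧ ¬ u =ᵐ[volume] 0

/-! ### Jordan chains -/

/-- `v 0, …, v (r - 1)` is a Jordan chain of the pencil `𝒜` at `z`:
`𝒜(z) v₀ = 0` with `v₀ ≠ 0`, and `𝒜(z) v_m = - v_{m-1}`. -/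
def IsJordanChain (ι : X →L[ℂ] Y) (A : ℝ → X →L[ℂ] Y) (z : ℂ) (r : ℕ) (v : ℕ → ℝ → X) : Prop :=
  0 < r ∧ (¬ v 0 =ᵐ[volume] 0) ∧ PencilEq ι A z (v 0) 0 ∧
    ∀ m, m + 1 < r → PencilEq ι A z (v (m + 1)) (fun t => - ι (v m t))

/-- `φ j m`, `j < J`, `m < mult j`, is a canonical system of Jordan chains of `𝒜` at `z`:
the eigenvectors `φ j 0` form a basis of the kernel of `𝒜(z)`, and `mult j` is the maximal length
of a Jordan chain whose eigenvector is not in the span of the `φ i 0`, `i < j`. -/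
structure IsCanonicalSystem (ι : X →L[ℂ] Y) (A : ℝ → X →L[ℂ] Y) (z : ℂ) (J : ℕ)
    (mult : Fin J → ℕ) (φ : Fin J → ℕ → ℝ → X) : Prop where
  chain : ∀ j, IsJordanChain ι A z (mult j) (φ j)
  indep : ∀ c : Fin J → ℂ, (∀ᵐ t, ∑ j, c j • φ j 0 t = 0) → c = 0
  span : ∀ u, PencilEq ι A z u 0 → ∃ c : Fin J → ℂ, ∀ᵐ t, u t = ∑ j, c j • φ j 0 t
  maximal : ∀ (j : Fin J) (r : ℕ) (v : ℕ → ℝ → X), IsJordanChain ι A z r v →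
    (¬ ∃ c : Fin J → ℂ, ∀ᵐ t, v 0 t = ∑ i ∈ Finset.univ.filter (· < j), c i • φ i 0 t) →
    r ≤ mult j

/-- `𝒜(z)* ψ = g`, where `ψ` and `g` are `1`-periodic elements of `L²_loc(ℝ; Y)` and the adjoint
`𝒜(z)* = - D_t + A(t)* + conj z` is taken with respect to the inner product over `(0, 1)`. -/
def AdjointEq (ι : X →L[ℂ] Y) (A : ℝ → X →L[ℂ] Y) (z : ℂ) (ψ g : ℝ → Y) : Prop :=
  MemYPer ψ ∧ MemYPer g ∧ ∀ (u : ℝ → X) (u' : ℝ → Y), MemXPer ι u u' →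
    innerPer (fun t => u' t + A t (u t) + z • ι (u t)) ψ = innerPer (fun t => ι (u t)) g

/-- `ψ 0, …, ψ (r - 1)` satisfy the Jordan chain equations of the adjoint pencil:
`𝒜(z)* ψ₀ = 0` and `𝒜(z)* ψ_m = - ψ_{m-1}`. -/
def IsAdjointChain (ι : X →L[ℂ] Y) (A : ℝ → X →L[ℂ] Y) (z : ℂ) (r : ℕ) (ψ : ℕ → ℝ → Y) : Prop :=
  (0 < r → AdjointEq ι A z (ψ 0) 0) ∧
    ∀ m, m + 1 < r → AdjointEq ι A z (ψ (m + 1)) (fun t => - ψ m t)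

/-! ### Pointwise pairing and the operator `𝒫` -/

/-- `(y, ψ(t)) = c`, where the value `ψ(t)` of `ψ ∈ L²_loc(ℝ; Y)` is understood as the (weak) limit
of the means of `ψ` over `(t - h, t + h)`. -/
def HasPairing (ψ : ℝ → Y) (t : ℝ) (y : Y) (c : ℂ) : Prop :=
  Tendsto (fun h => inner ℂ (mean ψ h t) y) (𝓝[>] 0) (𝓝 c)

/-- The number `(y, ψ(t))`; meaningful if `HasPairing ψ t y c` for some `c`. -/
def pairing (ψ : ℝ → Y) (t : ℝ) (y : Y) : ℂ :=
  limUnder (𝓝[>] 0) (fun h => inner ℂ (mean ψ h t) y)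

theorem HasPairing.eq {ψ : ℝ → Y} {t : ℝ} {y : Y} {c : ℂ} (h : HasPairing ψ t y c) :
    pairing ψ t y = c :=
  Tendsto.limUnder_eq h

theorem HasPairing.add {ψ : ℝ → Y} {t : ℝ} {y z : Y} {c d : ℂ}
    (h : HasPairing ψ t y c) (h' : HasPairing ψ t z d) : HasPairing ψ t (y + z) (c + d) := by
  simpa only [HasPairing, inner_add_right] using Tendsto.add h h'

theorem HasPairing.smul {ψ : ℝ → Y} {t : ℝ} {y : Y} {c : ℂ} (a : ℂ)
    (h : HasPairing ψ t y c) : HasPairing ψ t (a • y) (a * c) := by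
  simpa only [HasPairing, inner_smul_right] using Tendsto.const_mul a h

section Projector

variable {N : ℕ} {J : Fin N → ℕ} (mult : (k : Fin N) → Fin (J k) → ℕ)

/-- The coefficient `(u(t), ψ(t))` of a function `u` with values in `Y`. -/
def coeff (ψ : ℝ → Y) (u : ℝ → Y) (t : ℝ) : ℂ := pairing ψ t (u t)

/-- The sum of `c k j m • Φ k j (mult k j - 1 - m)` over all indices. -/
def chainSum {E : Type*} [AddCommGroup E] [Module ℂ E]
    (c : (k : Fin N) → Fin (J k) → ℕ → ℂ) (Φ : (k : Fin N) → Fin (J k) → ℕ → E) : E :=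
  ∑ k, ∑ j, ∑ m ∈ Finset.range (mult k j), c k j m • Φ k j (mult k j - 1 - m)

/-- The operator `𝒫(t) y = ∑ (y, ψ^k_{j,m}(t)) φ^k_{j, m_{k,j}-1-m}(t)` in `Y`, defined for all `y`
for which the numbers `(y, ψ^k_{j,m}(t))` exist. -/
def projAt (ι : X →L[ℂ] Y) (φ : (k : Fin N) → Fin (J k) → ℕ → ℝ → X)
    (ψ : (k : Fin N) → Fin (J k) → ℕ → ℝ → Y) (t : ℝ) : Y →ₗ.[ℂ] Y where
  domain :=
    { carrier := {y | ∀ k j m, m < mult k j → ∃ c, HasPairing (ψ k j m) t y c}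
      zero_mem' := fun k j m _ => ⟨0, by simp [HasPairing]⟩
      add_mem' := fun hy hz k j m hm =>
        let ⟨_, hc⟩ := hy k j m hm
        let ⟨_, hd⟩ := hz k j m hm
        ⟨_, hc.add hd⟩
      smul_mem' := fun a _ hy k j m hm =>
        let ⟨_, hc⟩ := hy k j m hm
        ⟨_, hc.smul a⟩ }
  toFun :=
    { toFun := fun y => chainSum mult (fun k j m => pairing (ψ k j m) t y)
        (fun k j m => valueAt (fun s => ι (φ k j m s)) t)
      map_add' := by
        rintro ⟨y, hy⟩ ⟨z, hz⟩
        simp only [chainSum, ← Finset.sum_add_distrib]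
        refine Finset.sum_congr rfl fun k _ => Finset.sum_congr rfl fun j _ =>
          Finset.sum_congr rfl fun m hm => ?_
        obtain ⟨c, hc⟩ := hy k j m (Finset.mem_range.1 hm)
        obtain ⟨d, hd⟩ := hz k j m (Finset.mem_range.1 hm)
        have h1 : pairing (ψ k j m) t (y + z) = c + d := (hc.add hd).eq
        simp only [Submodule.coe_add, h1, hc.eq, hd.eq, add_smul]
      map_smul' := by
        rintro a ⟨y, hy⟩
        simp only [chainSum, Finset.smul_sum, RingHom.id_apply]
        refine Finset.sum_congr rfl fun k _ => Finset.sum_congr rfl fun j _ =>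
          Finset.sum_congr rfl fun m hm => ?_
        obtain ⟨c, hc⟩ := hy k j m (Finset.mem_range.1 hm)
        have h1 : pairing (ψ k j m) t (a • y) = a * c := (hc.smul a).eq
        simp only [Submodule.coe_smul, h1, hc.eq, mul_smul] }

/-- The function `𝒫 f`, `(𝒫 f)(t) = 𝒫(t) f(t)`, for a function `f` with values in `Y`. -/
def projY (ι : X →L[ℂ] Y) (φ : (k : Fin N) → Fin (J k) → ℕ → ℝ → X)
    (ψ : (k : Fin N) → Fin (J k) → ℕ → ℝ → Y) (f : ℝ → Y) (t : ℝ) : Y :=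
  chainSum mult (fun k j m => coeff (ψ k j m) f t)
    (fun k j m => valueAt (fun s => ι (φ k j m s)) t)

/-- The coefficients `u^k_{j,m}(t) = (u(t), ψ^k_{j,m}(t))` of `u ∈ 𝒳_loc`, at every `t`. -/
def coeffX (ι : X →L[ℂ] Y) (ψ : (k : Fin N) → Fin (J k) → ℕ → ℝ → Y) (u : ℝ → X)
    (k : Fin N) (j : Fin (J k)) (m : ℕ) (t : ℝ) : ℂ :=
  coeff (ψ k j m) (valueAt (fun s => ι (u s))) t

/-- The function `𝒫 u` for `u ∈ 𝒳_loc`, as a function with values in `X`. -/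
def projX (ι : X →L[ℂ] Y) (φ : (k : Fin N) → Fin (J k) → ℕ → ℝ → X)
    (ψ : (k : Fin N) → Fin (J k) → ℕ → ℝ → Y) (u : ℝ → X) (t : ℝ) : X :=
  chainSum mult (fun k j m => coeffX ι ψ u k j m t) (fun k j m => φ k j m t)

end Projector

/-- A partially defined linear operator is a projector: it maps its domain to itself and `T² = T`
there. -/
def IsProjector (T : Y →ₗ.[ℂ] Y) : Prop :=
  ∀ y : T.domain, ∃ h : T y ∈ T.domain, T ⟨T y, h⟩ = T y

end Floquet

end

open Floquet

/-!
The proof rests on one identity. If `𝒜(z)* ψ = g`, then for every `u ∈ 𝒳_loc` the scalar function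
`(u, ψ)` has the weak derivative `(𝓛u + zu, ψ) - (u, g)` (`AdjointEq.isWeakDerivOn`): the adjoint
equation is only tested against periodic functions, but the periodization `∑ₙ (ηu)(t + n)` of a
cut-off `ηu` is one of them, and the integral over a period unfolds to an integral over `ℝ`.

Hence `(u, ψ)` agrees almost everywhere with an absolutely continuous function `c`. That `c(t)` is
the pairing `(u(t), ψ(t))` at *every* `t`, although `ψ` is only in `L²_loc`, is
`hasPairing_of_ae_eq`: replacing `u(s)` by `u(t)` in the mean of `(u(s), ψ(s))` over
`(t - h, t + h)` costs at most `(2h)⁻¹ ∫ ‖D_t u‖ ∫ ‖ψ‖`, which tends to zero by the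
Cauchy–Schwarz inequality. Constant `u` give the inclusion of `X` in the domain of `𝒫(t)`.

For the Jordan chains, the pairings `p_{a,m} = (φ_a, ψ_m)` are periodic and satisfy
`p_{a,m}' = (z' - z) p_{a,m} + p_{a,m-1} - p_{a-1,m}`. By induction on `a + m` they vanish if
`z' - z ∉ 2πiℤ` (`chain_pairing_eq_zero`). If `z' = z` they are constant, and periodicity forces
`p_{a,m-1} = p_{a-1,m}` (`chain_pairing_const`), so that all of them are determined by those with
the last `φ_a`, which are given by the normalization. This is the pointwise biorthogonality; it
makes `𝒫(t)` a projector, and boundedness follows from the density of `X` in `Y`.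

Finally the coefficients satisfy `(D_t - λ) u_m - u_{m-1} = (𝓛u, ψ_m)`, and the product rule for
absolutely continuous functions together with `𝓛φ_a = -λ φ_a - φ_{a-1}` and a shift of the
summation index gives `𝓛𝒫u = ∑ ((D_t - λ) u_m - u_{m-1}) φ_{r-1-m}` (`lEq_chainSum`), which is both
(iii) and, by the equation for the coefficients, (ii).
-/

open Floquet

namespace Floquet

/-! ### Absolutely continuous functions as primitives -/

section Primitive

theorem intervalIntegrable_of_locallyIntegrable {E : Type*} [NormedAddCommGroup E] {f : ℝ → E}
    (hf : LocallyIntegrable f) (a b : ℝ) : IntervalIntegrable f volume a b :=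
  intervalIntegrable_iff.mpr <|
    (hf.integrableOn_isCompact isCompact_uIcc).mono_set uIoc_subset_uIcc

theorem locallyIntegrable_comp_add_right {E : Type*} [NormedAddCommGroup E] {f : ℝ → E}
    (hf : LocallyIntegrable f) (d : ℝ) :
    LocallyIntegrable (fun t => f (t + d)) := by
  have h := intervalIntegrable_of_locallyIntegrable hf
  refine (locallyIntegrable_iff).2 fun K hK => ?_
  obtain ⟨M, hM⟩ := hK.isBounded.subset_closedBall 0
  rw [Real.closedBall_eq_Icc] at hM
  by_cases h0 : 0 ≤ M
  · refine IntegrableOn.mono_set ?_ hM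
    have h2 : IntervalIntegrable (fun t => f (t + d)) volume (0 - M) (0 + M) := by
      simpa using (h (0 - M + d) (0 + M + d)).comp_add_right d
    rwa [intervalIntegrable_iff_integrableOn_Icc_of_le (by linarith)] at h2
  · have : K ⊆ ∅ := hM.trans (by rw [Icc_eq_empty (by linarith)])
    exact integrableOn_empty.mono_set this

variable {E : Type*} [NormedAddCommGroup E] [NormedSpace ℝ E]

/-- `F` is a primitive of the locally integrable function `f`; that is, `F` is locally absolutely
continuous with derivative `f`. -/
def IsPrimitive (F f : ℝ → E) : Prop :=
  LocallyIntegrable f ∧ ∀ s t, ∫ x in s..t, f x = F t - F s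

theorem isPrimitive_integral {f : ℝ → E} (hf : LocallyIntegrable f) (a : ℝ) :
    IsPrimitive (fun t => ∫ x in a..t, f x) f := by
  have h := intervalIntegrable_of_locallyIntegrable hf
  exact ⟨hf, fun s t => (intervalIntegral.integral_interval_sub_left (h _ _) (h _ _)).symm⟩

theorem IsPrimitive.eq_add {F f : ℝ → E} (h : IsPrimitive F f) (a t : ℝ) :
    F t = F a + ∫ x in a..t, f x := by
  rw [h.2, add_sub_cancel]

theorem IsPrimitive.continuous {F f : ℝ → E} (h : IsPrimitive F f) : Continuous F := by
  have h1 : F = fun t => F 0 + ∫ x in (0 : ℝ)..t, f x := funext fun t => h.eq_add 0 t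
  rw [h1]
  exact continuous_const.add
    (intervalIntegral.continuous_primitive (intervalIntegrable_of_locallyIntegrable h.1) 0)

theorem IsPrimitive.congr {F f g : ℝ → E} (h : IsPrimitive F f) (hfg : f =ᵐ[volume] g) :
    IsPrimitive F g := by
  refine ⟨h.1.congr hfg, fun s t => ?_⟩
  rw [← h.2]
  exact intervalIntegral.integral_congr_ae (hfg.mono fun x hx _ => hx.symm)

theorem isPrimitive_const (e : E) : IsPrimitive (fun _ => e) (fun _ => (0 : E)) :=
  ⟨locallyIntegrable_zero, by simp⟩

theorem isPrimitive_of_contDiff [CompleteSpace E] {η : ℝ → E} (hη : ContDiff ℝ ∞ η) :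
    IsPrimitive η (deriv η) := by
  have hc : Continuous (deriv η) := hη.continuous_deriv (by simp)
  refine ⟨hc.locallyIntegrable, fun s t => ?_⟩
  exact intervalIntegral.integral_deriv_eq_sub
    (fun x _ => (hη.differentiable (by simp)).differentiableAt) (hc.intervalIntegrable _ _)

theorem IsPrimitive.add {F f G g : ℝ → E} (h : IsPrimitive F f) (h' : IsPrimitive G g) :
    IsPrimitive (fun t => F t + G t) (fun t => f t + g t) := by
  refine ⟨h.1.add h'.1, fun s t => ?_⟩
  rw [intervalIntegral.integral_add (intervalIntegrable_of_locallyIntegrable h.1 _ _)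
    (intervalIntegrable_of_locallyIntegrable h'.1 _ _), h.2, h'.2]
  exact (add_sub_add_comm _ _ _ _).symm

theorem IsPrimitive.sum {κ : Type*} (s : Finset κ) {F f : κ → ℝ → E}
    (h : ∀ i ∈ s, IsPrimitive (F i) (f i)) :
    IsPrimitive (fun t => ∑ i ∈ s, F i t) (fun t => ∑ i ∈ s, f i t) := by
  classical
  induction s using Finset.induction_on with
  | empty => simpa using isPrimitive_const (0 : E)
  | insert a s ha ih =>
    simp only [Finset.sum_insert ha]
    exact (h a (by simp)).add (ih fun i hi => h i (by simp [hi]))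

theorem IsPrimitive.comp_add_right {F f : ℝ → E} (h : IsPrimitive F f) (d : ℝ) :
    IsPrimitive (fun t => F (t + d)) (fun t => f (t + d)) := by
  refine ⟨locallyIntegrable_comp_add_right h.1 d, fun s t => ?_⟩
  rw [intervalIntegral.integral_comp_add_right, h.2]

/-- Integration over the triangle `a < y < x ≤ b` in either order. -/
theorem integral_smul_primitive_eq [CompleteSpace E] {𝕜 : Type*} [RCLike 𝕜] [NormedSpace 𝕜 E]
    {c : ℝ → 𝕜} {f : ℝ → E} {a b : ℝ} (hab : a ≤ b) (hc : LocallyIntegrable c)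
    (hf : LocallyIntegrable f) :
    ∫ x in a..b, c x • ∫ y in a..x, f y = ∫ y in a..b, (∫ x in y..b, c x) • f y := by
  set μ := volume.restrict (Ioc a b) with hμ
  have hcμ : Integrable c μ :=
    (intervalIntegrable_iff_integrableOn_Ioc_of_le hab).1
      (intervalIntegrable_of_locallyIntegrable hc a b)
  have hfμ : Integrable f μ :=
    (intervalIntegrable_iff_integrableOn_Ioc_of_le hab).1
      (intervalIntegrable_of_locallyIntegrable hf a b)
  have hK : Integrable (Function.uncurry
      (fun x y => {p : ℝ × ℝ | p.2 < p.1}.indicator (fun p => c p.1 • f p.2) (x, y)))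
      (μ.prod μ) :=
    (hcμ.smul_prod hfμ).indicator (measurableSet_lt measurable_snd measurable_fst)
  have key := integral_integral_swap hK
  rw [intervalIntegral.integral_of_le hab, intervalIntegral.integral_of_le hab]
  have e1 : ∫ x in Ioc a b, c x • ∫ y in a..x, f y = ∫ x, ∫ y,
      {p : ℝ × ℝ | p.2 < p.1}.indicator (fun p => c p.1 • f p.2) (x, y) ∂μ ∂μ := by
    refine setIntegral_congr_fun measurableSet_Ioc fun x hx => ?_
    have : (fun y => {p : ℝ × ℝ | p.2 < p.1}.indicator (fun p => c p.1 • f p.2) (x, y))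
        = (Iio x).indicator (fun y => c x • f y) := by
      ext y; simp [indicator]
    simp only [this]
    rw [hμ, setIntegral_indicator measurableSet_Iio,
      show Ioc a b ∩ Iio x = Ioo a x by ext y; simp only [mem_inter_iff, mem_Ioc, mem_Iio, mem_Ioo];
                                        grind,
      ← integral_Ioc_eq_integral_Ioo, integral_smul, intervalIntegral.integral_of_le hx.1.le]
  have e2 : ∫ y in Ioc a b, (∫ x in y..b, c x) • f y = ∫ y, ∫ x,
      {p : ℝ × ℝ | p.2 < p.1}.indicator (fun p => c p.1 • f p.2) (x, y) ∂μ ∂μ := by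
    refine setIntegral_congr_fun measurableSet_Ioc fun y hy => ?_
    have : (fun x => {p : ℝ × ℝ | p.2 < p.1}.indicator (fun p => c p.1 • f p.2) (x, y))
        = (Ioi y).indicator (fun x => c x • f y) := by
      ext x; simp [indicator]
    simp only [this]
    rw [hμ, setIntegral_indicator measurableSet_Ioi,
      show Ioc a b ∩ Ioi y = Ioc y b by ext x; simp only [mem_inter_iff, mem_Ioc, mem_Ioi]; grind,
      integral_smul_const, intervalIntegral.integral_of_le hy.2]
  rw [e1, e2, key]

/-- The product rule for absolutely continuous functions. -/
theorem IsPrimitive.smul [CompleteSpace E] {𝕜 : Type*} [RCLike 𝕜] [NormedSpace 𝕜 E]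
    {c c' : ℝ → 𝕜} {F f : ℝ → E} (hc : IsPrimitive c c') (hF : IsPrimitive F f) :
    IsPrimitive (fun t => c t • F t) (fun t => c' t • F t + c t • f t) := by
  have i1 : LocallyIntegrable (fun t => c' t • F t) := hc.1.smul_continuous hF.continuous
  have i2 : LocallyIntegrable (fun t => c t • f t) := hF.1.continuous_smul hc.continuous
  have J1 := intervalIntegrable_of_locallyIntegrable i1
  have J2 := intervalIntegrable_of_locallyIntegrable i2
  have main : ∀ a b, a ≤ b →
      ∫ x in a..b, (c' x • F x + c x • f x) = c b • F b - c a • F a := by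
    intro a b hab
    have key := integral_smul_primitive_eq hab hc.1 hF.1
    simp only [hF.2, hc.2, smul_sub, sub_smul] at key
    rw [intervalIntegral.integral_sub (J1 a b), intervalIntegral.integral_sub _ (J2 a b),
      intervalIntegral.integral_smul_const, intervalIntegral.integral_smul, hF.2, hc.2] at key
    · rw [intervalIntegral.integral_add (J1 a b) (J2 a b), eq_add_of_sub_eq key]
      simp only [smul_sub, sub_smul]
      abel
    · exact (intervalIntegrable_of_locallyIntegrable hF.1 a b).smul (c b)
    · exact intervalIntegrable_of_locallyIntegrable (hc.1.smul_continuous continuous_const) a b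
  refine ⟨i1.add i2, fun s t => ?_⟩
  rcases le_total s t with h | h
  · exact main s t h
  · rw [intervalIntegral.integral_symm, main t s h, neg_sub]

/-! ### Weak derivatives -/

theorem exists_tsupport_subset_Ioo {η : ℝ → ℝ} (hη : HasCompactSupport η) :
    ∃ M : ℕ, 0 < M ∧ tsupport η ⊆ Ioo (-M : ℝ) M := by
  obtain ⟨R, hR⟩ := (show IsCompact (tsupport η) from hη).isBounded.subset_ball 0
  obtain ⟨M, hM⟩ := exists_nat_gt (max R 0)
  refine ⟨M, by exact_mod_cast (le_max_right R 0).trans_lt hM, hR.trans ?_⟩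
  rw [Real.ball_eq_Ioo]
  have := (le_max_left R 0).trans_lt hM
  exact Ioo_subset_Ioo (by linarith) (by linarith)

theorem eq_zero_of_tsupport_subset {η : ℝ → ℝ} {M t : ℝ} (hη : tsupport η ⊆ Ioo (-M) M)
    (ht : t ∉ Ioo (-M) M) : η t = 0 :=
  image_eq_zero_of_notMem_tsupport fun h => ht (hη h)

theorem IsWeakDerivOn.congr {Ω : Set ℝ} {f g f₁ g₁ : ℝ → E} (h : IsWeakDerivOn Ω f g)
    (hf : f =ᵐ[volume] f₁) (hg : g =ᵐ[volume] g₁) : IsWeakDerivOn Ω f₁ g₁ := by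
  refine ⟨h.1.congr (ae_restrict_of_ae hf), h.2.1.congr (ae_restrict_of_ae hg),
    fun η h1 h2 h3 => ?_⟩
  rw [← integral_congr_ae (hf.mono fun t ht => by simp [ht] :
      (fun t => deriv η t • f t) =ᵐ[volume] fun t => deriv η t • f₁ t),
    ← integral_congr_ae (hg.mono fun t ht => by simp [ht] :
      (fun t => η t • g t) =ᵐ[volume] fun t => η t • g₁ t)]
  exact h.2.2 η h1 h2 h3

theorem IsWeakDerivOn.mono {Ω Ω' : Set ℝ} {f g : ℝ → E} (h : IsWeakDerivOn Ω f g) (hΩ : Ω' ⊆ Ω) :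
    IsWeakDerivOn Ω' f g :=
  ⟨h.1.mono_set hΩ, h.2.1.mono_set hΩ, fun η h1 h2 h3 => h.2.2 η h1 h2 (h3.trans hΩ)⟩

theorem IsPrimitive.isWeakDerivOn [CompleteSpace E] {F f : ℝ → E} (h : IsPrimitive F f) :
    IsWeakDerivOn univ F f := by
  refine ⟨h.continuous.locallyIntegrable.locallyIntegrableOn _, h.1.locallyIntegrableOn _,
    fun η h1 h2 _ => ?_⟩
  obtain ⟨M, hM0, hM⟩ := exists_tsupport_subset_Ioo h2
  have hp := (isPrimitive_of_contDiff h1).smul h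
  have i1 : Integrable (fun t => deriv η t • F t) :=
    h.continuous.locallyIntegrable.integrable_smul_left_of_hasCompactSupport
      (h1.continuous_deriv (by simp)) h2.deriv
  have i2 : Integrable (fun t => η t • f t) :=
    h.1.integrable_smul_left_of_hasCompactSupport h1.continuous h2
  have h0 := hp.2 (-M) M
  beta_reduce at h0
  rw [eq_zero_of_tsupport_subset hM (by simp), eq_zero_of_tsupport_subset hM (by simp),
    intervalIntegral.integral_eq_integral_of_support_subset, integral_add i1 i2] at h0
  · exact eq_neg_of_add_eq_zero_left (by simpa using h0)
  · intro t ht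
    by_contra hn
    have hn' : t ∉ Ioo (-M : ℝ) M := fun h => hn (Ioo_subset_Ioc_self h)
    apply ht
    have h3 : deriv η t = 0 :=
      image_eq_zero_of_notMem_tsupport fun h => hn' (hM (tsupport_deriv_subset h))
    simp [eq_zero_of_tsupport_subset hM hn', h3]

/-- A function with vanishing weak derivative is constant: every test function is, up to a multiple
of a fixed one with integral `1`, the derivative of a test function. -/
theorem ae_const_of_integral_deriv_smul_eq_zero [CompleteSpace E] {f : ℝ → E}
    (hf : LocallyIntegrable f)
    (h : ∀ η : ℝ → ℝ, ContDiff ℝ ∞ η → HasCompactSupport η → ∫ t, deriv η t • f t = 0) :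
    ∃ e : E, f =ᵐ[volume] fun _ => e := by
  let b : ContDiffBump (0 : ℝ) := ⟨1, 2, by norm_num, by norm_num⟩
  set ρ : ℝ → ℝ := b.normed volume
  have hρ1 : ContDiff ℝ ∞ ρ := b.contDiff_normed
  have hρ2 : HasCompactSupport ρ := b.hasCompactSupport_normed
  have hρ3 : ∫ t, ρ t = 1 := b.integral_normed
  refine ⟨∫ t, ρ t • f t, ?_⟩
  suffices ∀ᵐ t, f t - ∫ t, ρ t • f t = 0 from this.mono fun t ht => sub_eq_zero.1 ht
  refine ae_eq_zero_of_integral_contDiff_smul_eq_zero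
    (hf.sub (locallyIntegrable_const _)) fun η h1 h2 => ?_
  set I : ℝ := ∫ t, η t
  -- `ζ` has integral zero, so its primitive `θ` has compact support
  set ζ : ℝ → ℝ := fun t => η t - I * ρ t
  have hζ1 : ContDiff ℝ ∞ ζ := h1.sub (contDiff_const.mul hρ1)
  obtain ⟨M, hM0, hM⟩ := exists_tsupport_subset_Ioo h2
  obtain ⟨M', hM0', hM'⟩ := exists_tsupport_subset_Ioo hρ2
  set K : ℝ := max M M'
  have hζ0 : ∀ t, t ∉ Ioo (-K) K → ζ t = 0 := by
    intro t ht
    have a1 : η t = 0 := eq_zero_of_tsupport_subset hM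
      fun h => ht (Ioo_subset_Ioo (neg_le_neg (le_max_left _ _)) (le_max_left _ _) h)
    have a2 : ρ t = 0 := eq_zero_of_tsupport_subset hM'
      fun h => ht (Ioo_subset_Ioo (neg_le_neg (le_max_right _ _)) (le_max_right _ _) h)
    simp [ζ, a1, a2]
  have i1 : Integrable η := h1.continuous.integrable_of_hasCompactSupport h2
  have i2 : Integrable ρ := hρ1.continuous.integrable_of_hasCompactSupport hρ2
  have hζI : ∫ t, ζ t = 0 := by
    simp only [ζ]
    rw [integral_sub i1 (i2.const_mul I), integral_const_mul, hρ3]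
    simp [I]
  set θ : ℝ → ℝ := fun t => ∫ s in (-K)..t, ζ s
  have hθd : deriv θ = ζ := funext fun t => hζ1.continuous.deriv_integral ζ (-K) t
  have hθ1 : ContDiff ℝ ∞ θ := by
    refine contDiff_infty_iff_deriv.2 ⟨fun t => ?_, hθd ▸ hζ1⟩
    exact (hζ1.continuous.integral_hasStrictDerivAt (-K) t).hasDerivAt.differentiableAt
  have hθ2 : HasCompactSupport θ := by
    refine HasCompactSupport.intro (isCompact_Icc (a := -K) (b := K)) fun t ht => ?_
    have hK : 0 ≤ K := le_max_of_le_left (by positivity)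
    rcases lt_or_ge t (-K) with hlt | hge
    · refine (intervalIntegral.integral_congr (g := fun _ => (0 : ℝ)) fun s hs => ?_).trans
        (by simp)
      rw [uIcc_of_ge hlt.le] at hs
      exact hζ0 s fun h => by linarith [h.1, hs.2]
    · have hgt : K < t := by
        by_contra hle
        exact ht ⟨hge, not_lt.1 hle⟩
      have : θ t = ∫ s, ζ s := by
        refine intervalIntegral.integral_eq_integral_of_support_subset fun s hs => ?_
        by_contra hn
        exact hs (hζ0 s fun h => hn ⟨h.1, by linarith [h.2]⟩)
      rw [this, hζI]
  have h0 := h θ hθ1 hθ2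
  rw [hθd] at h0
  have j1 : Integrable (fun t => η t • f t) :=
    hf.integrable_smul_left_of_hasCompactSupport h1.continuous h2
  have j2 : Integrable (fun t => ρ t • f t) :=
    hf.integrable_smul_left_of_hasCompactSupport hρ1.continuous hρ2
  simp only [ζ, sub_smul, mul_smul] at h0
  rw [integral_sub j1 (show Integrable (fun t => I • ρ t • f t) from j2.smul I),
    integral_smul] at h0
  simp only [smul_sub]
  rw [integral_sub j1 (i1.smul_const _), integral_smul_const]
  exact h0

/-- A function with a weak derivative on `ℝ` has an absolutely continuous representative. -/
theorem IsWeakDerivOn.exists_isPrimitive [CompleteSpace E] {f g : ℝ → E}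
    (h : IsWeakDerivOn univ f g) : ∃ F, IsPrimitive F g ∧ F =ᵐ[volume] f := by
  have hf : LocallyIntegrable f := locallyIntegrableOn_univ.1 h.1
  have hg : LocallyIntegrable g := locallyIntegrableOn_univ.1 h.2.1
  have hG := isPrimitive_integral hg 0
  obtain ⟨e, he⟩ := ae_const_of_integral_deriv_smul_eq_zero
    (f := fun t => f t - ∫ x in (0 : ℝ)..t, g x) (hf.sub hG.continuous.locallyIntegrable)
    fun η h1 h2 => by
      have a1 := h.2.2 η h1 h2 (subset_univ _)
      have a2 := hG.isWeakDerivOn.2.2 η h1 h2 (subset_univ _)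
      simp only [smul_sub]
      have hd : Continuous (deriv η) := h1.continuous_deriv (by simp)
      rw [integral_sub (hf.integrable_smul_left_of_hasCompactSupport hd h2.deriv)
        (hG.continuous.locallyIntegrable.integrable_smul_left_of_hasCompactSupport hd h2.deriv),
        a1, a2, sub_self]
  refine ⟨fun t => e + ∫ x in (0 : ℝ)..t, g x, ?_, he.mono fun t ht => ?_⟩
  · simpa using (isPrimitive_const e).add hG
  · simp [← ht]

/-! ### Lebesgue values -/

theorem hasValueAt_of_hasDerivAt {f : ℝ → E} {t : ℝ} {e : E} (hf : LocallyIntegrable f)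
    (h : HasDerivAt (fun x => ∫ s in (0 : ℝ)..x, f s) e t) : HasValueAt f t e := by
  have hi := intervalIntegrable_of_locallyIntegrable hf
  have h1 : HasDerivAt (fun x : ℝ => (∫ s in (0 : ℝ)..(t + x), f s) - ∫ s in (0 : ℝ)..(t - x), f s)
      (e + e) 0 := by
    have a1 := HasDerivAt.comp_const_add t (0 : ℝ) (by simpa using h)
    have a2 := HasDerivAt.comp_const_sub t (0 : ℝ) (by simpa using h)
    simpa using a1.fun_sub a2
  have h2 := (hasDerivAt_iff_tendsto_slope.1 h1).mono_left
    (nhdsWithin_mono (0 : ℝ) (show Ioi (0 : ℝ) ⊆ {0}ᶜ from fun x hx => (ne_of_gt hx)))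
  have h3 := h2.const_smul (2⁻¹ : ℝ)
  rw [← two_smul ℝ e, smul_smul, inv_mul_cancel₀ two_ne_zero, one_smul] at h3
  refine h3.congr fun x => ?_
  simp only [slope, mean, sub_zero, add_zero, sub_self, vsub_eq_sub]
  rw [intervalIntegral.integral_interval_sub_left (hi _ _) (hi _ _), smul_smul, mul_inv]

theorem hasValueAt_of_continuous [CompleteSpace E] {f : ℝ → E} (hf : Continuous f) (t : ℝ) :
    HasValueAt f t (f t) :=
  hasValueAt_of_hasDerivAt hf.locallyIntegrable (hf.integral_hasStrictDerivAt 0 t).hasDerivAt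

theorem ae_hasValueAt [CompleteSpace E] {f : ℝ → E} (hf : LocallyIntegrable f) :
    ∀ᵐ t, HasValueAt f t (f t) :=
  (LocallyIntegrable.ae_hasDerivAt_integral hf).mono fun _ ht => hasValueAt_of_hasDerivAt hf (ht 0)

theorem mean_congr {f g : ℝ → E} (h : f =ᵐ[volume] g) (r t : ℝ) : mean f r t = mean g r t := by
  rw [mean, mean, intervalIntegral.integral_congr_ae (h.mono fun x hx _ => hx)]

theorem hasValueAt_of_ae_eq [CompleteSpace E] {F f : ℝ → E} (hF : Continuous F)
    (h : F =ᵐ[volume] f) (t : ℝ) : HasValueAt f t (F t) := by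
  have := hasValueAt_of_continuous hF t
  simpa only [HasValueAt, mean_congr h] using this

theorem valueAt_of_ae_eq [CompleteSpace E] {F f : ℝ → E} (hF : Continuous F)
    (h : F =ᵐ[volume] f) : valueAt f = F :=
  funext fun t => Tendsto.limUnder_eq (hasValueAt_of_ae_eq hF h t)

end Primitive

/-! ### Locally square integrable functions -/

section L2Loc

variable {E F : Type*} [NormedAddCommGroup E] [NormedAddCommGroup F]

theorem MemL2Loc.aestronglyMeasurable {f : ℝ → E} (hf : MemL2Loc f) :
    AEStronglyMeasurable f volume := by
  have h : ⋃ n : ℕ, Ioo (-n : ℝ) n = univ := by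
    refine eq_univ_of_forall fun x => mem_iUnion.2 ?_
    obtain ⟨n, hn⟩ := exists_nat_gt |x|
    exact ⟨n, abs_lt.1 hn⟩
  rw [← Measure.restrict_univ (μ := volume), ← h, aestronglyMeasurable_iUnion_iff]
  exact fun n => (hf _ _).1

theorem locallyIntegrable_of_Ioo {f : ℝ → E} (h : ∀ a b : ℝ, IntegrableOn f (Ioo a b)) :
    LocallyIntegrable f := by
  intro x
  exact ⟨Ioo (x - 1) (x + 1), Ioo_mem_nhds (by linarith) (by linarith), h _ _⟩

theorem MemL2Loc.locallyIntegrable {f : ℝ → E} (hf : MemL2Loc f) : LocallyIntegrable f :=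
  locallyIntegrable_of_Ioo fun a b => (hf a b).integrable (by norm_num)

theorem MemL2Loc.locallyIntegrable_sq {f : ℝ → E} (hf : MemL2Loc f) :
    LocallyIntegrable (fun t => ‖f t‖ ^ 2) :=
  locallyIntegrable_of_Ioo fun a b => (hf a b).integrable_norm_pow (by norm_num)

theorem MemL2Loc.of_norm_le {f : ℝ → E} {g : ℝ → F} {C : ℝ → ℝ} (hf : MemL2Loc f)
    (hg : AEStronglyMeasurable g volume) (hC : Continuous C) (h : ∀ t, ‖g t‖ ≤ C t * ‖f t‖) :
    MemL2Loc g := by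
  intro a b
  obtain ⟨K, hK⟩ := (isCompact_Icc (a := a) (b := b)).bddAbove_image hC.continuousOn
  refine (hf a b).of_le_mul hg.restrict (c := K) ?_
  filter_upwards [ae_restrict_mem measurableSet_Ioo] with t ht
  exact (h t).trans (mul_le_mul_of_nonneg_right
    (hK (mem_image_of_mem _ (Ioo_subset_Icc_self ht))) (norm_nonneg _))

theorem MemL2Loc.add {f g : ℝ → E} (hf : MemL2Loc f) (hg : MemL2Loc g) :
    MemL2Loc (fun t => f t + g t) := fun a b => (hf a b).add (hg a b)

theorem MemL2Loc.sum {κ : Type*} (s : Finset κ) {f : κ → ℝ → E} (h : ∀ i ∈ s, MemL2Loc (f i)) :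
    MemL2Loc (fun t => ∑ i ∈ s, f i t) := fun a b => memLp_finsetSum s fun i hi => h i hi a b

theorem MemL2Loc.continuous_smul {𝕜 : Type*} [NormedField 𝕜] [NormedSpace 𝕜 E]
    [SecondCountableTopology 𝕜] {c : ℝ → 𝕜} {f : ℝ → E}
    (hc : Continuous c) (hf : MemL2Loc f) : MemL2Loc (fun t => c t • f t) :=
  hf.of_norm_le (hc.aestronglyMeasurable.smul hf.aestronglyMeasurable) hc.norm
    fun _ => (norm_smul _ _).le

theorem MemL2Loc.comp_add_right {f : ℝ → E} (hf : MemL2Loc f) (d : ℝ) :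
    MemL2Loc (fun t => f (t + d)) := by
  intro a b
  have h := (measurePreserving_add_right volume d).restrict_preimage
    (measurableSet_Ioo (a := a + d) (b := b + d))
  have e : (fun x : ℝ => x + d) ⁻¹' Ioo (a + d) (b + d) = Ioo a b := by ext x; simp
  rw [e] at h
  exact (hf (a + d) (b + d)).comp_measurePreserving h

theorem MemL2Loc.locallyIntegrable_inner [InnerProductSpace ℂ E] {f g : ℝ → E} (hf : MemL2Loc f)
    (hg : MemL2Loc g) : LocallyIntegrable (fun t => inner ℂ (f t) (g t)) := by
  have h := hf.locallyIntegrable_sq.add hg.locallyIntegrable_sq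
  refine h.mono (hf.aestronglyMeasurable.inner hg.aestronglyMeasurable) (ae_of_all _ fun t => ?_)
  have h1 := norm_inner_le_norm (𝕜 := ℂ) (f t) (g t)
  rw [Pi.add_apply, Real.norm_of_nonneg (by positivity)]
  nlinarith [sq_nonneg (‖f t‖ - ‖g t‖), sq_nonneg (‖f t‖ + ‖g t‖)]

end L2Loc

section XLoc

variable {X Y : Type*} [NormedAddCommGroup X] [InnerProductSpace ℂ X]
  [NormedAddCommGroup Y] [InnerProductSpace ℂ Y]

theorem MemL2Loc.clm {u : ℝ → X} (hu : MemL2Loc u) {A : ℝ → X →L[ℂ] Y} (hA : Continuous A) :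
    MemL2Loc (fun t => A t (u t)) :=
  hu.of_norm_le
    (isBoundedBilinearMap_apply.continuous.comp_aestronglyMeasurable
      (hA.aestronglyMeasurable.prodMk hu.aestronglyMeasurable))
    hA.norm fun t => (A t).le_opNorm _

theorem MemXLoc.memL2Loc {ι : X →L[ℂ] Y} {u : ℝ → X} {u' : ℝ → Y} (h : MemXLoc ι u u') :
    MemL2Loc u := by
  intro a b
  by_cases hab : a < b
  · exact (h a b hab).1
  · simp [Ioo_eq_empty hab]

theorem MemXLoc.memL2Loc_deriv {ι : X →L[ℂ] Y} {u : ℝ → X} {u' : ℝ → Y} (h : MemXLoc ι u u') :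
    MemL2Loc u' := by
  intro a b
  by_cases hab : a < b
  · exact (h a b hab).2.1
  · simp [Ioo_eq_empty hab]

theorem MemXLoc.exists_isPrimitive [CompleteSpace Y] {ι : X →L[ℂ] Y} {u : ℝ → X} {u' : ℝ → Y}
    (h : MemXLoc ι u u') : ∃ U, IsPrimitive U u' ∧ U =ᵐ[volume] fun t => ι (u t) := by
  refine IsWeakDerivOn.exists_isPrimitive
    ⟨((h.memL2Loc.clm continuous_const).locallyIntegrable).locallyIntegrableOn _,
      h.memL2Loc_deriv.locallyIntegrable.locallyIntegrableOn _, fun η h1 h2 _ => ?_⟩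
  obtain ⟨M, hM0, hM⟩ := exists_tsupport_subset_Ioo h2
  have hM0' : (0 : ℝ) < M := by exact_mod_cast hM0
  exact (h (-M) M (by linarith)).2.2.2.2 η h1 h2 hM

theorem memXLoc_of_isPrimitive [CompleteSpace Y] {ι : X →L[ℂ] Y} {u : ℝ → X} {u' U : ℝ → Y}
    (hu : MemL2Loc u) (hu' : MemL2Loc u') (hU : IsPrimitive U u')
    (h : U =ᵐ[volume] fun t => ι (u t)) : MemXLoc ι u u' :=
  fun a b _ => ⟨hu a b, hu' a b, (hU.isWeakDerivOn.congr h ae_eq_rfl).mono (subset_univ _)⟩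

end XLoc

/-! ### Periodization -/

section Periodize

variable {E : Type*} [NormedAddCommGroup E]

/-- The `1`-periodic function `∑ₙ F(t + n)`, used for `F` with bounded support, where the sum is
locally finite. -/
noncomputable def periodize (F : ℝ → E) (t : ℝ) : E := ∑' n : ℤ, F (t + n)

theorem periodize_periodic (F : ℝ → E) : Function.Periodic (periodize F) 1 := by
  intro t
  rw [periodize, periodize, ← (Equiv.addRight (1 : ℤ)).tsum_eq (fun n : ℤ => F (t + n))]
  refine tsum_congr fun n => ?_
  simp only [Equiv.coe_addRight, Int.cast_add, Int.cast_one]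
  congr 1
  ring

theorem periodize_eq_sum {F : ℝ → E} {M K : ℕ} (hF : ∀ t, t ∉ Ioo (-M : ℝ) M → F t = 0) {t : ℝ}
    (ht : t ∈ Icc (-K : ℝ) K) :
    periodize F t = ∑ n ∈ Finset.Icc (-(M + K : ℤ)) (M + K), F (t + n) := by
  refine tsum_eq_sum fun n hn => hF _ fun h => hn ?_
  rw [Finset.mem_Icc]
  constructor
  · have : (-(M + K) : ℝ) < n := by linarith [h.1, ht.2]
    exact_mod_cast this.le
  · have : (n : ℝ) < M + K := by linarith [h.2, ht.1]
    exact_mod_cast this.le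

theorem exists_nat_Icc_superset (a b : ℝ) : ∃ K : ℕ, a ∈ Icc (-K : ℝ) K ∧ b ∈ Icc (-K : ℝ) K := by
  obtain ⟨K, hK⟩ := exists_nat_ge (max |a| |b|)
  exact ⟨K, abs_le.1 ((le_max_left _ _).trans hK), abs_le.1 ((le_max_right _ _).trans hK)⟩

theorem memL2Loc_periodize {F : ℝ → E} {M : ℕ} (hF : ∀ t, t ∉ Ioo (-M : ℝ) M → F t = 0)
    (h : MemL2Loc F) : MemL2Loc (periodize F) := by
  intro a b
  obtain ⟨K, ha, hb⟩ := exists_nat_Icc_superset a b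
  have h1 : MemLp (fun t => ∑ n ∈ Finset.Icc (-(M + K : ℤ)) (M + K), F (t + n)) 2
      (volume.restrict (Ioo a b)) :=
    MemL2Loc.sum (f := fun (n : ℤ) t => F (t + n)) _ (fun n _ => h.comp_add_right n) a b
  refine h1.ae_eq ?_
  filter_upwards [ae_restrict_mem measurableSet_Ioo] with t ht
  exact (periodize_eq_sum hF ⟨ha.1.trans ht.1.le, ht.2.le.trans hb.2⟩).symm

theorem IsPrimitive.periodize [NormedSpace ℝ E] {F f : ℝ → E} {M : ℕ}
    (hF : ∀ t, t ∉ Ioo (-M : ℝ) M → F t = 0) (hf : ∀ t, t ∉ Ioo (-M : ℝ) M → f t = 0)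
    (hi : LocallyIntegrable (periodize f)) (h : IsPrimitive F f) :
    IsPrimitive (periodize F) (Floquet.periodize f) := by
  refine ⟨hi, fun s t => ?_⟩
  obtain ⟨K, hs, ht⟩ := exists_nat_Icc_superset s t
  have h1 := (IsPrimitive.sum (Finset.Icc (-(M + K : ℤ)) (M + K))
    (fun n _ => h.comp_add_right (n : ℝ))).2 s t
  rw [periodize_eq_sum hF hs, periodize_eq_sum hF ht, ← h1]
  refine intervalIntegral.integral_congr fun x hx => ?_
  exact periodize_eq_sum hf (uIcc_subset_Icc hs ht hx)

theorem periodize_congr_ae {F G : ℝ → E} (h : F =ᵐ[volume] G) :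
    periodize F =ᵐ[volume] periodize G := by
  have h1 : ∀ᵐ t : ℝ, ∀ n : ℤ, F (t + n) = G (t + n) := by
    rw [ae_all_iff]
    exact fun n => (measurePreserving_add_right volume (n : ℝ)).quasiMeasurePreserving.ae h
  exact h1.mono fun t ht => tsum_congr ht

theorem sum_integral_add_int_eq_integral {G : ℝ → ℂ} {M K : ℕ}
    (hG : ∀ t, t ∉ Ioo (-M : ℝ) M → G t = 0) (hi : LocallyIntegrable G) :
    ∑ n ∈ Finset.Icc (-(M + K : ℤ)) (M + K), ∫ t in (0 : ℝ)..1, G (t + n) = ∫ t, G t := by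
  have h1 : ∑ n ∈ Finset.Icc (-(M + K : ℤ)) (M + K), ∫ t in (0 : ℝ)..1, G (t + n)
      = ∑ k ∈ Finset.range (2 * (M + K) + 1), ∫ t in ((k : ℝ) - (M + K))..(((k + 1 : ℕ) : ℝ) -
        (M + K)), G t := by
    refine Finset.sum_nbij' (fun n => (n + (M + K)).toNat) (fun k => (k : ℤ) - (M + K))
      ?_ ?_ ?_ ?_ ?_
    · intro n hn
      simp only [Finset.mem_Icc, Finset.mem_range] at hn ⊢
      omega
    · intro k hk
      simp only [Finset.mem_Icc, Finset.mem_range] at hk ⊢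
      omega
    · intro n hn
      simp only [Finset.mem_Icc] at hn ⊢
      omega
    · intro k hk
      simp
    · intro n hn
      simp only [Finset.mem_Icc] at hn
      have e : (((n + (M + K)).toNat : ℕ) : ℝ) = n + (M + K) := by
        have : (((n + (M + K)).toNat : ℕ) : ℤ) = n + (M + K) := Int.toNat_of_nonneg (by omega)
        exact_mod_cast this
      rw [intervalIntegral.integral_comp_add_right, Nat.cast_add, e]
      congr 1 <;> push_cast <;> ring
  rw [h1, intervalIntegral.sum_integral_adjacent_intervals (a := fun k : ℕ => (k : ℝ) - (M + K))
    fun k _ => intervalIntegrable_of_locallyIntegrable hi _ _]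
  refine intervalIntegral.integral_eq_integral_of_support_subset fun t ht => ?_
  by_contra hn
  refine ht (hG t fun h => hn ⟨?_, ?_⟩)
  · have := h.1
    push_cast
    linarith [(Nat.cast_nonneg K : (0 : ℝ) ≤ K)]
  · have := h.2
    push_cast
    linarith [(Nat.cast_nonneg K : (0 : ℝ) ≤ K), (Nat.cast_nonneg M : (0 : ℝ) ≤ M)]

/-- Unfolding: the periodic inner product with a periodization is an integral over `ℝ`. -/
theorem innerPer_periodize [InnerProductSpace ℂ E] {F ψ : ℝ → E} {M : ℕ}
    (hF0 : ∀ t, t ∉ Ioo (-M : ℝ) M → F t = 0)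
    (hF : MemL2Loc F) (hψ : MemYPer ψ) :
    innerPer (periodize F) ψ = ∫ t, inner ℂ (ψ t) (F t) := by
  have hi := hψ.1.locallyIntegrable_inner hF
  rw [← sum_integral_add_int_eq_integral (K := 1) (G := fun t => inner ℂ (ψ t) (F t))
    (fun t ht => by simp [hF0 t ht]) hi, innerPer,
    ← intervalIntegral.integral_finsetSum fun n _ => ?_]
  · refine intervalIntegral.integral_congr fun t ht => ?_
    rw [uIcc_of_le zero_le_one] at ht
    have hp : ∀ n : ℤ, ψ (t + n) = ψ t := fun n => by simpa using hψ.2.int_mul n t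
    simp only [hp]
    rw [periodize_eq_sum (K := 1) hF0 ⟨by push_cast; linarith [ht.1], by push_cast; exact ht.2⟩,
      inner_sum]
  · exact intervalIntegrable_of_locallyIntegrable (locallyIntegrable_comp_add_right hi n) _ _

end Periodize

/-! ### Weak solutions of the adjoint equation -/

section Adjoint

variable {X Y : Type*} [NormedAddCommGroup X] [InnerProductSpace ℂ X]
  [NormedAddCommGroup Y] [InnerProductSpace ℂ Y] [CompleteSpace Y]

/-- If `𝒜(z)* ψ = g`, then `D_t (u, ψ) = (𝓛 u + z u, ψ) - (u, g)` for every `u ∈ 𝒳_loc`: for a test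
function `η`, use the periodization of `η u` in the definition of the adjoint. -/
theorem AdjointEq.isWeakDerivOn {ι : X →L[ℂ] Y} {A : ℝ → X →L[ℂ] Y} (hA : Continuous A)
    (hper : Function.Periodic A 1) {z : ℂ} {ψ g : ℝ → Y} (h : AdjointEq ι A z ψ g) {u : ℝ → X}
    {u' : ℝ → Y} (hu : MemXLoc ι u u') :
    IsWeakDerivOn univ (fun t => inner ℂ (ψ t) (ι (u t)))
      (fun t => inner ℂ (ψ t) (u' t + A t (u t) + z • ι (u t)) - inner ℂ (g t) (ι (u t))) := by
  obtain ⟨hψ, hg, h⟩ := h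
  obtain ⟨U, hU, hUu⟩ := hu.exists_isPrimitive
  have hιu : MemL2Loc (fun t => ι (u t)) := hu.memL2Loc.clm continuous_const
  have hL : MemL2Loc (fun t => u' t + A t (u t) + z • ι (u t)) :=
    (hu.memL2Loc_deriv.add (hu.memL2Loc.clm hA)).add (hιu.continuous_smul continuous_const)
  have j1 := hψ.1.locallyIntegrable_inner hιu
  have j2 := hψ.1.locallyIntegrable_inner hL
  have j3 := hg.1.locallyIntegrable_inner hιu
  refine ⟨j1.locallyIntegrableOn _, (j2.sub j3).locallyIntegrableOn _, fun η h1 h2 _ => ?_⟩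
  obtain ⟨M, hM0, hM⟩ := exists_tsupport_subset_Ioo h2
  have hη0 : ∀ t, t ∉ Ioo (-M : ℝ) M → η t = 0 := fun t ht => eq_zero_of_tsupport_subset hM ht
  have hη0' : ∀ t, t ∉ Ioo (-M : ℝ) M → deriv η t = 0 := fun t ht =>
    image_eq_zero_of_notMem_tsupport fun h => ht (hM (tsupport_deriv_subset h))
  have hηc : Continuous η := h1.continuous
  have hηc' : Continuous (deriv η) := h1.continuous_deriv (by simp)
  set w : ℝ → X := periodize fun t => η t • u t
  set w' : ℝ → Y := periodize fun t => deriv η t • ι (u t) + η t • u' t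
  have hw : MemL2Loc w := memL2Loc_periodize (M := M) (fun t ht => by simp [hη0 t ht])
    (hu.memL2Loc.continuous_smul hηc)
  have hw' : MemL2Loc w' := memL2Loc_periodize (M := M) (fun t ht => by simp [hη0 t ht, hη0' t ht])
    ((hιu.continuous_smul hηc').add (hu.memL2Loc_deriv.continuous_smul hηc))
  have hιw : (fun t => ι (w t)) = periodize fun t => η t • ι (u t) := by
    ext t
    obtain ⟨K, hK, -⟩ := exists_nat_Icc_superset t t
    simp only [w]
    rw [periodize_eq_sum (M := M) (fun t ht => by simp [hη0 t ht]) hK,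
      periodize_eq_sum (M := M) (fun t ht => by simp [hη0 t ht]) hK, map_sum]
    refine Finset.sum_congr rfl fun n _ => ?_
    exact (ι.restrictScalars ℝ).map_smul _ _
  have hLw : (fun t => w' t + A t (w t) + z • ι (w t)) = periodize fun t =>
      deriv η t • ι (u t) + η t • (u' t + A t (u t) + z • ι (u t)) := by
    ext t
    obtain ⟨K, hK, -⟩ := exists_nat_Icc_superset t t
    simp only [w, w']
    rw [periodize_eq_sum (M := M) (fun t ht => by simp [hη0 t ht, hη0' t ht]) hK,
      periodize_eq_sum (M := M) (fun t ht => by simp [hη0 t ht]) hK,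
      periodize_eq_sum (M := M) (fun t ht => by simp [hη0 t ht, hη0' t ht]) hK, map_sum, map_sum,
      Finset.smul_sum, ← Finset.sum_add_distrib, ← Finset.sum_add_distrib]
    refine Finset.sum_congr rfl fun n _ => ?_
    have hAn : A (t + n) = A t := by simpa using hper.int_mul n t
    have e1 : A t (η (t + n) • u (t + n)) = η (t + n) • A t (u (t + n)) :=
      ((A t).restrictScalars ℝ).map_smul _ _
    have e2 : ι (η (t + n) • u (t + n)) = η (t + n) • ι (u (t + n)) :=
      (ι.restrictScalars ℝ).map_smul _ _
    rw [e1, e2, hAn, smul_comm z, smul_add, smul_add]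
    abel
  have hwX : MemXPer ι w w' := by
    refine ⟨?_, periodize_periodic _⟩
    have hp := (isPrimitive_of_contDiff h1).smul hU
    have e : w' =ᵐ[volume] periodize fun t => deriv η t • U t + η t • u' t :=
      periodize_congr_ae (hUu.mono fun t ht => by simp [ht])
    refine memXLoc_of_isPrimitive hw hw' ((hp.periodize (M := M) (fun t ht => by simp [hη0 t ht])
      (fun t ht => by simp [hη0 t ht, hη0' t ht]) (hw'.locallyIntegrable.congr e)).congr e.symm) ?_
    rw [hιw]
    exact periodize_congr_ae (hUu.mono fun t ht => by simp [ht])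
  have key := h w w' hwX
  rw [hιw, hLw, innerPer_periodize (M := M) (fun t ht => by simp [hη0 t ht, hη0' t ht])
    ((hιu.continuous_smul hηc').add (hL.continuous_smul hηc)) hψ,
    innerPer_periodize (M := M) (fun t ht => by simp [hη0 t ht]) (hιu.continuous_smul hηc)
      hg] at key
  have hreal : ∀ (r : ℝ) (x y : Y), inner ℂ x (r • y) = r • inner ℂ x y := fun r x y =>
    inner_smul_right_eq_smul _ _ _
  simp only [inner_add_right (E := Y) _ (deriv η _ • _), hreal] at key
  have i1 := j1.integrable_smul_left_of_hasCompactSupport hηc' h2.deriv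
  have i2 := j2.integrable_smul_left_of_hasCompactSupport hηc h2
  have i3 := j3.integrable_smul_left_of_hasCompactSupport hηc h2
  rw [integral_add i1 i2] at key
  simp only [smul_sub]
  rw [integral_sub i2 i3, ← key]
  ring

end Adjoint

/-! ### Pointwise pairings -/

section Pairing

variable {X Y : Type*} [NormedAddCommGroup X] [InnerProductSpace ℂ X]
  [NormedAddCommGroup Y] [InnerProductSpace ℂ Y]

/-- The equations of an adjoint chain in a uniform form, with `ψ_{-1} = 0`. -/
theorem IsAdjointChain.adjointEq {ι : X →L[ℂ] Y} {A : ℝ → X →L[ℂ] Y} {z : ℂ} {r : ℕ}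
    {ψ : ℕ → ℝ → Y} (h : IsAdjointChain ι A z r ψ) {m : ℕ}
    (hm : m < r) :
    AdjointEq ι A z (ψ m) (fun t => if m = 0 then 0 else - ψ (m - 1) t) := by
  cases m with
  | zero => exact h.1 hm
  | succ m => simpa using h.2 m hm

variable [CompleteSpace Y]

theorem inner_mean {ψ : ℝ → Y} (hψ : LocallyIntegrable ψ) (h t : ℝ) (y : Y) :
    inner ℂ (mean ψ h t) y = mean (fun s => inner ℂ (ψ s) y) h t := by
  let T : Y →L[ℝ] ℂ := Complex.conjCLE.toContinuousLinearMap ∘L ((innerSL ℂ y).restrictScalars ℝ)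
  have hT : ∀ x, T x = inner ℂ x y := fun x => by simp [T]
  simp only [← hT, mean, map_smul]
  rw [ContinuousLinearMap.intervalIntegral_comp_comm _
    (intervalIntegrable_of_locallyIntegrable hψ _ _)]

theorem sq_integral_le {f : ℝ → ℝ} {a b : ℝ} (hab : a < b) (hf : IntervalIntegrable f volume a b)
    (hf2 : IntervalIntegrable (fun t => f t ^ 2) volume a b) :
    (∫ t in a..b, f t) ^ 2 ≤ (b - a) * ∫ t in a..b, f t ^ 2 := by
  set I := ∫ t in a..b, f t with hI
  -- the variance of `f`, up to a factor, is nonnegative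
  have h0 : 0 ≤ ∫ t in a..b, ((b - a) * f t - I) ^ 2 :=
    intervalIntegral.integral_nonneg hab.le fun t _ => sq_nonneg _
  have e : ∀ t, ((b - a) * f t - I) ^ 2
      = (b - a) ^ 2 * f t ^ 2 + ((-(2 * (b - a) * I)) * f t + I ^ 2) := fun t => by ring
  simp only [e] at h0
  rw [intervalIntegral.integral_add (hf2.const_mul _) ((hf.const_mul _).add (by simp)),
    intervalIntegral.integral_add (hf.const_mul _) (by simp), intervalIntegral.integral_const_mul,
    intervalIntegral.integral_const_mul, intervalIntegral.integral_const, ← hI, smul_eq_mul] at h0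
  have hb : 0 < b - a := by linarith
  have h1 : 0 ≤ (b - a) * ((b - a) * ∫ t in a..b, f t ^ 2) - (b - a) * I ^ 2 := by
    ring_nf at h0 ⊢
    linarith
  have := nonneg_of_mul_nonneg_right (a := b - a) (b := ((b - a) * ∫ t in a..b, f t ^ 2) - I ^ 2)
    (by linarith) hb
  linarith

theorem tendsto_integral_symm_interval {f : ℝ → ℝ} (hf : LocallyIntegrable f) (t : ℝ) :
    Tendsto (fun h => ∫ s in (t - h)..(t + h), f s) (𝓝[>] 0) (𝓝 0) := by
  have hp := isPrimitive_integral hf 0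
  have hc := hp.continuous
  have : Continuous fun h : ℝ => (∫ x in (0 : ℝ)..(t + h), f x) - ∫ x in (0 : ℝ)..(t - h), f x :=
    (hc.comp (continuous_const.add continuous_id)).sub
      (hc.comp (continuous_const.sub continuous_id))
  refine Tendsto.congr (fun h => (hp.2 _ _).symm) ?_
  simpa using (this.tendsto 0).mono_left nhdsWithin_le_nhds

/-- Let `U` have a derivative in `L²_loc` and `ψ ∈ L²_loc`. If `(U, ψ)` agrees almost everywhere
with a continuous function `c`, then the pairing `(U(t), ψ(t))` exists at every `t` and is `c(t)`.
Freezing `U` at `t` in the means costs at most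
`(2h)⁻¹ ∫ ‖U'‖ ∫ ‖ψ‖ ≤ ½ ∫ (‖U'‖² + ‖ψ‖²)`, integrated over `(t - h, t + h)`. -/
theorem hasPairing_of_ae_eq {U u' ψ : ℝ → Y} {c : ℝ → ℂ} (hU : IsPrimitive U u')
    (hu' : MemL2Loc u') (hψ : MemL2Loc ψ) (hc : Continuous c)
    (h : c =ᵐ[volume] fun t => inner ℂ (ψ t) (U t)) (t : ℝ) : HasPairing ψ t (U t) (c t) := by
  have hv : Tendsto (fun h => mean c h t) (𝓝[>] 0) (𝓝 (c t)) := hasValueAt_of_continuous hc t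
  set d : ℝ → ℝ := fun r => 2⁻¹ * ((∫ s in (t - r)..(t + r), ‖u' s‖ ^ 2)
    + ∫ s in (t - r)..(t + r), ‖ψ s‖ ^ 2) with hd
  have hd0 : Tendsto d (𝓝[>] 0) (𝓝 0) := by
    rw [hd]
    simpa using ((tendsto_integral_symm_interval hu'.locallyIntegrable_sq t).add
      (tendsto_integral_symm_interval hψ.locallyIntegrable_sq t)).const_mul 2⁻¹
  refine tendsto_of_tendsto_of_dist hv (squeeze_zero' (Eventually.of_forall fun _ => dist_nonneg)
    ?_ hd0)
  filter_upwards [self_mem_nhdsWithin] with r hr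
  have hr : 0 < r := hr
  have hab : t - r < t + r := by linarith
  have Iψ := intervalIntegrable_of_locallyIntegrable hψ.locallyIntegrable (t - r) (t + r)
  have Iu := intervalIntegrable_of_locallyIntegrable hu'.locallyIntegrable (t - r) (t + r)
  have Iψ2 := intervalIntegrable_of_locallyIntegrable hψ.locallyIntegrable_sq (t - r) (t + r)
  have Iu2 := intervalIntegrable_of_locallyIntegrable hu'.locallyIntegrable_sq (t - r) (t + r)
  set a := ∫ s in (t - r)..(t + r), ‖u' s‖
  set b := ∫ s in (t - r)..(t + r), ‖ψ s‖
  have J1 : IntervalIntegrable c volume (t - r) (t + r) := hc.intervalIntegrable _ _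
  have J2 : IntervalIntegrable (fun s => inner ℂ (ψ s) (U t)) volume (t - r) (t + r) := by
    refine (Iψ.norm.mul_const ‖U t‖).mono_fun
      (hψ.aestronglyMeasurable.inner aestronglyMeasurable_const).restrict
      (ae_of_all _ fun s => ?_)
    beta_reduce
    rw [Real.norm_of_nonneg (by positivity)]
    exact norm_inner_le_norm _ _
  have hUs : ∀ s ∈ Ioc (t - r) (t + r), ‖U s - U t‖ ≤ a := by
    intro s hs
    have h1 : ‖∫ x in t..s, u' x‖ ≤ |∫ x in t..s, ‖u' x‖| :=
      intervalIntegral.norm_integral_le_abs_integral_norm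
    rw [← hU.2]
    refine h1.trans ?_
    refine (intervalIntegral.abs_integral_mono_interval (c := t - r) (d := t + r) ?_
      (ae_of_all _ fun x => norm_nonneg _) Iu.norm).trans
      (abs_of_nonneg (intervalIntegral.integral_nonneg hab.le fun _ _ => norm_nonneg _)).le
    rw [uIoc_of_le hab.le]
    intro x hx
    rcases le_total t s with h | h
    · rw [uIoc_of_le h] at hx
      exact ⟨by linarith [hx.1], hx.2.trans hs.2⟩
    · rw [uIoc_of_ge h] at hx
      exact ⟨by linarith [hx.1, hs.1], by linarith [hx.2]⟩
  have hdiff : ‖∫ s in (t - r)..(t + r), (c s - inner ℂ (ψ s) (U t))‖ ≤ a * b := by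
    rw [← intervalIntegral.integral_const_mul]
    refine intervalIntegral.norm_integral_le_of_norm_le hab.le ?_ (Iψ.norm.const_mul a)
    filter_upwards [h] with s hs hsI
    rw [hs, ← inner_sub_right]
    refine (norm_inner_le_norm _ _).trans ?_
    rw [mul_comm]
    exact mul_le_mul_of_nonneg_right (hUs s hsI) (norm_nonneg _)
  rw [inner_mean hψ.locallyIntegrable, dist_eq_norm, mean, mean, ← smul_sub,
    ← intervalIntegral.integral_sub J1 J2, norm_smul, Real.norm_of_nonneg (by positivity)]
  refine (mul_le_mul_of_nonneg_left hdiff (by positivity)).trans ?_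
  have ha2 := sq_integral_le hab Iu.norm Iu2
  have hb2 := sq_integral_le hab Iψ.norm Iψ2
  rw [show t + r - (t - r) = 2 * r by ring] at ha2 hb2
  rw [inv_mul_le_iff₀ (by positivity), hd]
  nlinarith [sq_nonneg (a - b)]

/-- The Lebesgue values of `u ∈ 𝒳_loc` form its absolutely continuous representative. -/
theorem MemXLoc.valueAt {ι : X →L[ℂ] Y} {u : ℝ → X} {u' : ℝ → Y} (h : MemXLoc ι u u') :
    IsPrimitive (valueAt fun s => ι (u s)) u' ∧
      valueAt (fun s => ι (u s)) =ᵐ[volume] fun t => ι (u t) := by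
  obtain ⟨U, hU, hUu⟩ := h.exists_isPrimitive
  rw [valueAt_of_ae_eq hU.continuous hUu]
  exact ⟨hU, hUu⟩

theorem MemXLoc.hasValueAt {ι : X →L[ℂ] Y} {u : ℝ → X} {u' : ℝ → Y} (h : MemXLoc ι u u') (t : ℝ) :
    HasValueAt (fun s => ι (u s)) t (Floquet.valueAt (fun s => ι (u s)) t) :=
  hasValueAt_of_ae_eq h.valueAt.1.continuous h.valueAt.2 t

variable {ι : X →L[ℂ] Y} {A : ℝ → X →L[ℂ] Y} {z : ℂ}

/-- Pointwise form of `AdjointEq.isWeakDerivOn`: the pairing `(u(t), ψ(t))` exists at every `t` and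
is absolutely continuous, with derivative `(𝓛 u + z u, ψ) - (u, g)`. -/
theorem AdjointEq.pairing (hA : Continuous A) (hper : Function.Periodic A 1) {ψ g : ℝ → Y}
    (h : AdjointEq ι A z ψ g) {u : ℝ → X} {u' : ℝ → Y} (hu : MemXLoc ι u u') :
    (∀ t, HasPairing ψ t (valueAt (fun s => ι (u s)) t) (coeff ψ (valueAt fun s => ι (u s)) t)) ∧
    (coeff ψ (valueAt fun s => ι (u s)) =ᵐ[volume] fun t => inner ℂ (ψ t) (ι (u t))) ∧
    IsPrimitive (coeff ψ (valueAt fun s => ι (u s)))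
      (fun t => inner ℂ (ψ t) (u' t + A t (u t) + z • ι (u t)) - inner ℂ (g t) (ι (u t))) := by
  obtain ⟨c, hc, hcu⟩ := (h.isWeakDerivOn hA hper hu).exists_isPrimitive
  obtain ⟨hU, hUu⟩ := hu.valueAt
  have hp := hasPairing_of_ae_eq hU hu.memL2Loc_deriv h.1.1 hc.continuous
    (hcu.trans (hUu.mono fun t ht => by simp [ht]))
  have e : coeff ψ (valueAt fun s => ι (u s)) = c := funext fun t => (hp t).eq
  rw [e]
  exact ⟨hp, hcu, hc⟩

theorem IsAdjointChain.hasPairing (hA : Continuous A) (hper : Function.Periodic A 1) {r : ℕ}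
    {ψ : ℕ → ℝ → Y} (h : IsAdjointChain ι A z r ψ) {u : ℝ → X} {u' : ℝ → Y}
    (hu : MemXLoc ι u u') {m : ℕ} (hm : m < r) (t : ℝ) :
    HasPairing (ψ m) t (valueAt (fun s => ι (u s)) t)
      (coeff (ψ m) (valueAt fun s => ι (u s)) t) :=
  ((h.adjointEq hm).pairing hA hper hu).1 t

theorem IsAdjointChain.coeff_ae_eq (hA : Continuous A) (hper : Function.Periodic A 1) {r : ℕ}
    {ψ : ℕ → ℝ → Y} (h : IsAdjointChain ι A z r ψ) {u : ℝ → X} {u' : ℝ → Y}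
    (hu : MemXLoc ι u u') {m : ℕ} (hm : m < r) :
    coeff (ψ m) (valueAt fun s => ι (u s)) =ᵐ[volume] fun t => inner ℂ (ψ m t) (ι (u t)) :=
  ((h.adjointEq hm).pairing hA hper hu).2.1

/-- The coefficients `u_m = (u, ψ_m)` satisfy `(D_t - z) u_m - u_{m-1} = (𝓛 u, ψ_m)`. -/
theorem IsAdjointChain.isPrimitive_coeff (hA : Continuous A) (hper : Function.Periodic A 1) {r : ℕ}
    {ψ : ℕ → ℝ → Y} (h : IsAdjointChain ι A z r ψ) {u : ℝ → X} {u' : ℝ → Y}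
    (hu : MemXLoc ι u u') {m : ℕ} (hm : m < r) :
    IsPrimitive (coeff (ψ m) (valueAt fun s => ι (u s)))
      (fun t => inner ℂ (ψ m t) (u' t + A t (u t))
        + z * coeff (ψ m) (valueAt fun s => ι (u s)) t
        + if m = 0 then 0 else coeff (ψ (m - 1)) (valueAt fun s => ι (u s)) t) := by
  refine ((h.adjointEq hm).pairing hA hper hu).2.2.congr ?_
  have h1 := h.coeff_ae_eq hA hper hu hm
  have h2 := h.coeff_ae_eq hA hper hu (m := m - 1) (by omega)
  filter_upwards [h1, h2] with t ht1 ht2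
  rw [ht1, ht2]
  split_ifs with h0
  · simp
  · simp

end Pairing

/-! ### Biorthogonality -/

section Biorthogonal

variable {X Y : Type*} [NormedAddCommGroup X] [InnerProductSpace ℂ X]
  [NormedAddCommGroup Y] [InnerProductSpace ℂ Y]
  {ι : X →L[ℂ] Y} {A : ℝ → X →L[ℂ] Y} {z z' : ℂ}

theorem mean_add_one {E : Type*} [NormedAddCommGroup E] [NormedSpace ℝ E] {f : ℝ → E}
    (hf : Function.Periodic f 1) (h t : ℝ) : mean f h (t + 1) = mean f h t := by
  rw [mean, mean, show t + 1 - h = t - h + 1 by ring, show t + 1 + h = t + h + 1 by ring,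
    ← intervalIntegral.integral_comp_add_right]
  simp only [hf _]

theorem coeff_valueAt_periodic {ψ f : ℝ → Y} (hψ : Function.Periodic ψ 1)
    (hf : Function.Periodic f 1) : Function.Periodic (coeff ψ (valueAt f)) 1 := by
  intro t
  simp only [coeff, pairing, valueAt, mean_add_one hψ, mean_add_one hf]

theorem IsPrimitive.hasDerivAt {p f : ℝ → ℂ} (h : IsPrimitive p f) (hf : Continuous f) (t : ℝ) :
    HasDerivAt p (f t) t := by
  have e : p = fun t => p 0 + ∫ x in (0 : ℝ)..t, f x := funext fun t => h.eq_add 0 t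
  rw [e]
  exact (hf.integral_hasStrictDerivAt 0 t).hasDerivAt.const_add _

/-- A periodic solution of `p' = μ p` vanishes unless `μ ∈ 2πiℤ`. -/
theorem eq_zero_of_periodic {p : ℝ → ℂ} {μ : ℂ} (hμ : Complex.exp μ ≠ 1)
    (h : IsPrimitive p fun t => μ * p t) (hp : Function.Periodic p 1) (t : ℝ) : p t = 0 := by
  have hd := h.hasDerivAt (continuous_const.mul h.continuous)
  set q : ℝ → ℂ := fun t => Complex.exp (-(μ * t)) * p t
  have hq : ∀ t, HasDerivAt q 0 t := by
    intro t
    have h1 : HasDerivAt (fun t : ℝ => Complex.exp (-(μ * t)))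
        (Complex.exp (-(μ * t)) * (-(μ * 1))) t :=
      (((hasDerivAt_id t).ofReal_comp.const_mul μ).neg).cexp
    refine (h1.mul (hd t)).congr_deriv ?_
    ring
  have hq0 : ∀ s, q s = q 0 := fun s =>
    is_const_of_deriv_eq_zero (fun x => (hq x).differentiableAt) (fun x => (hq x).deriv) s 0
  have hp1 : p 1 = p 0 := by simpa using hp 0
  have h1 := hq0 1
  simp only [q, hp1, Complex.ofReal_one, mul_one, Complex.ofReal_zero, mul_zero, neg_zero,
    Complex.exp_zero, one_mul] at h1
  have hp0 : p 0 = 0 := by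
    by_contra hne
    apply hμ
    have h2 : Complex.exp (-μ) = 1 := mul_right_cancel₀ hne (by rw [h1, one_mul])
    rw [Complex.exp_neg, inv_eq_one] at h2
    exact h2
  have h3 := hq0 t
  simp only [q, hp0, mul_zero] at h3
  exact (mul_eq_zero.1 h3).resolve_left (Complex.exp_ne_zero _)

theorem const_of_periodic {p : ℝ → ℂ} {d : ℂ} (h : IsPrimitive p fun _ => d)
    (hp : Function.Periodic p 1) : d = 0 ∧ ∀ t, p t = p 0 := by
  have hp1 : p 1 = p 0 := by simpa using hp 0
  have hd : d = 0 := by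
    have := h.2 0 1
    simpa [hp1] using this
  refine ⟨hd, fun t => ?_⟩
  have := h.2 0 t
  rw [hd] at this
  exact sub_eq_zero.1 (by simpa using this.symm)

theorem exp_sub_ne_one {a b : ℂ} (hne : a ≠ b) (ha : a.im ∈ Ico 0 (2 * Real.pi))
    (hb : b.im ∈ Ico 0 (2 * Real.pi)) : Complex.exp (a - b) ≠ 1 := by
  intro h
  obtain ⟨n, hn⟩ := Complex.exp_eq_one_iff.1 h
  have him : a.im - b.im = n * (2 * Real.pi) := by
    have := congrArg Complex.im hn
    simpa using this
  have hre : a.re - b.re = 0 := by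
    have := congrArg Complex.re hn
    simpa using this
  have hpi := Real.pi_pos
  have h1 : (n : ℝ) < 1 := by
    by_contra h'
    nlinarith [ha.2, hb.1, not_lt.1 h']
  have h2 : (-1 : ℝ) < n := by
    by_contra h'
    nlinarith [ha.1, hb.2, not_lt.1 h']
  have hn0 : n = 0 := by
    have h1' : n < 1 := by exact_mod_cast h1
    have h2' : -1 < n := by exact_mod_cast h2
    omega
  rw [hn0] at hn
  exact hne (sub_eq_zero.1 (by simpa using hn))

/-- The equations `𝓛 φ_a = - z φ_a - φ_{a-1}` of a Jordan chain. -/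
theorem IsJordanChain.exists_deriv {r : ℕ} {φ : ℕ → ℝ → X} (h : IsJordanChain ι A z r φ) {a : ℕ}
    (ha : a < r) : ∃ φ' : ℝ → Y, MemXPer ι (φ a) φ' ∧
      ∀ᵐ t, φ' t + A t (φ a t) = -(z • ι (φ a t)) - if a = 0 then 0 else ι (φ (a - 1) t) := by
  cases a with
  | zero =>
    obtain ⟨φ', h1, h2⟩ := h.2.2.1
    refine ⟨φ', h1, h2.mono fun t ht => ?_⟩
    simpa using eq_neg_of_add_eq_zero_left ht
  | succ a =>
    obtain ⟨φ', h1, h2⟩ := h.2.2.2 a ha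
    refine ⟨φ', h1, h2.mono fun t ht => ?_⟩
    rw [eq_sub_of_add_eq ht]
    simp only [Nat.add_eq_zero_iff, one_ne_zero, and_false, if_false, Nat.add_sub_cancel]
    abel

theorem chain_pairing_periodic {r r' : ℕ} {φ : ℕ → ℝ → X} {ψ : ℕ → ℝ → Y}
    (hφ : IsJordanChain ι A z r φ) (hψ : IsAdjointChain ι A z' r' ψ) {a m : ℕ} (ha : a < r)
    (hm : m < r') :
    Function.Periodic (coeff (ψ m) (valueAt fun s => ι (φ a s))) 1 := by
  obtain ⟨φ', h1, -⟩ := hφ.exists_deriv ha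
  refine coeff_valueAt_periodic (hψ.adjointEq hm).1.2 fun t => ?_
  simp only [h1.2 t]

section

variable [CompleteSpace Y] (hA : Continuous A) (hper : Function.Periodic A 1) {r r' : ℕ}
  {φ : ℕ → ℝ → X} {ψ : ℕ → ℝ → Y} (hφ : IsJordanChain ι A z r φ) (hψ : IsAdjointChain ι A z' r' ψ)
include hA hper hφ hψ

/-- The functions `p_{a,m} = (φ_a, ψ_m)` satisfy
`p_{a,m}' = (z' - z) p_{a,m} + p_{a,m-1} - p_{a-1,m}`. -/
theorem isPrimitive_chain_pairing {a m : ℕ} (ha : a < r) (hm : m < r') :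
    IsPrimitive (coeff (ψ m) (valueAt fun s => ι (φ a s)))
      (fun t => (z' - z) * coeff (ψ m) (valueAt fun s => ι (φ a s)) t
        + ((if m = 0 then 0 else coeff (ψ (m - 1)) (valueAt fun s => ι (φ a s)) t)
          - if a = 0 then 0 else coeff (ψ m) (valueAt fun s => ι (φ (a - 1) s)) t)) := by
  obtain ⟨φ', h1, h2⟩ := hφ.exists_deriv ha
  obtain ⟨φ₁, h3, -⟩ := hφ.exists_deriv (a := a - 1) (by omega)
  refine (hψ.isPrimitive_coeff hA hper h1.1 hm).congr ?_
  filter_upwards [h2, hψ.coeff_ae_eq hA hper h1.1 hm, hψ.coeff_ae_eq hA hper h3.1 hm]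
    with t ht1 ht2 ht3
  rw [ht1, ht2, ht3, inner_sub_right, inner_neg_right, inner_smul_right]
  by_cases h0 : a = 0
  · simp only [h0, if_true, inner_zero_right]
    ring
  · simp only [h0, if_false]
    ring

/-- For eigenvalues that differ modulo `2πi` all pairings vanish, by induction on `a + m`. -/
theorem chain_pairing_eq_zero (hz : Complex.exp (z' - z) ≠ 1) {a m : ℕ} (ha : a < r)
    (hm : m < r') (t : ℝ) : coeff (ψ m) (valueAt fun s => ι (φ a s)) t = 0 := by
  induction hn : a + m using Nat.strong_induction_on generalizing a m t with
  | _ n ih =>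
  refine eq_zero_of_periodic hz ?_ (chain_pairing_periodic hφ hψ ha hm) t
  refine (isPrimitive_chain_pairing hA hper hφ hψ ha hm).congr (ae_of_all _ fun t => ?_)
  have e1 : (if m = 0 then 0 else coeff (ψ (m - 1)) (valueAt fun s => ι (φ a s)) t) = 0 := by
    split_ifs with h0
    · rfl
    · exact ih (a + (m - 1)) (by omega) ha (by omega) t rfl
  have e2 : (if a = 0 then 0 else coeff (ψ m) (valueAt fun s => ι (φ (a - 1) s)) t) = 0 := by
    split_ifs with h0
    · rfl
    · exact ih (a - 1 + m) (by omega) (by omega) hm t rfl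
  simp [e1, e2]

end

section

variable [CompleteSpace Y] (hA : Continuous A) (hper : Function.Periodic A 1) {r r' : ℕ}
  {φ : ℕ → ℝ → X} {ψ : ℕ → ℝ → Y} (hφ : IsJordanChain ι A z r φ) (hψ : IsAdjointChain ι A z r' ψ)
include hA hper hφ hψ

/-- For equal eigenvalues the pairings `p_{a,m}` are constant, and the periodicity of `p_{a,m}`
forces `p_{a,m-1} = p_{a-1,m}`. -/
theorem chain_pairing_const {a m : ℕ} (ha : a < r) (hm : m < r') :
    (∀ t, coeff (ψ m) (valueAt fun s => ι (φ a s)) t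
      = coeff (ψ m) (valueAt fun s => ι (φ a s)) 0) ∧
    ∀ t, (if a = 0 then 0 else coeff (ψ m) (valueAt fun s => ι (φ (a - 1) s)) t)
      = if m = 0 then 0 else coeff (ψ (m - 1)) (valueAt fun s => ι (φ a s)) t := by
  induction hn : a + m using Nat.strong_induction_on generalizing a m with
  | _ n ih =>
  have e1 : ∀ t, (if m = 0 then 0 else coeff (ψ (m - 1)) (valueAt fun s => ι (φ a s)) t)
      = if m = 0 then 0 else coeff (ψ (m - 1)) (valueAt fun s => ι (φ a s)) 0 := by
    intro t
    split_ifs with h0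
    · rfl
    · exact (ih (a + (m - 1)) (by omega) ha (by omega) rfl).1 t
  have e2 : ∀ t, (if a = 0 then 0 else coeff (ψ m) (valueAt fun s => ι (φ (a - 1) s)) t)
      = if a = 0 then 0 else coeff (ψ m) (valueAt fun s => ι (φ (a - 1) s)) 0 := by
    intro t
    split_ifs with h0
    · rfl
    · exact (ih (a - 1 + m) (by omega) (by omega) hm rfl).1 t
  have hp := isPrimitive_chain_pairing hA hper hφ hψ ha hm
  simp only [sub_self, zero_mul, zero_add, e1, e2] at hp
  obtain ⟨h1, h2⟩ := const_of_periodic hp (chain_pairing_periodic hφ hψ ha hm)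
  refine ⟨h2, fun t => ?_⟩
  rw [e1, e2]
  exact (sub_eq_zero.1 h1).symm

/-- All pairings are reduced to those with the last element `φ_{r-1}` of the chain by raising `a`
and lowering `m`; the value is `0` if `m` runs out first. -/
theorem chain_pairing_shift {b m : ℕ} (hb : b < r) (hm : m < r') (t : ℝ) :
    coeff (ψ m) (valueAt fun s => ι (φ (r - 1 - b) s)) t
      = if b ≤ m then coeff (ψ (m - b)) (valueAt fun s => ι (φ (r - 1) s)) t else 0 := by
  induction b generalizing m with
  | zero => simp
  | succ b ih =>
    have h := (chain_pairing_const hA hper hφ hψ (a := r - 1 - b) (by omega) hm).2 t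
    rw [if_neg (by omega), show r - 1 - b - 1 = r - 1 - (b + 1) by omega] at h
    rw [h]
    by_cases hm0 : m = 0
    · simp [hm0]
    · rw [if_neg hm0, ih (by omega) (by omega)]
      by_cases hbm : b + 1 ≤ m
      · rw [if_pos hbm, if_pos (by omega), show m - 1 - b = m - (b + 1) by omega]
      · rw [if_neg hbm, if_neg (by omega)]

/-- The constant value of a pairing is its integral over a period. -/
theorem chain_pairing_eq_innerPer {a m : ℕ} (ha : a < r) (hm : m < r') (t : ℝ) :
    coeff (ψ m) (valueAt fun s => ι (φ a s)) t = innerPer (fun t => ι (φ a t)) (ψ m) := by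
  obtain ⟨φ', h1, -⟩ := hφ.exists_deriv ha
  have hc := (chain_pairing_const hA hper hφ hψ ha hm).1
  have he := hψ.coeff_ae_eq hA hper h1.1 hm
  rw [innerPer, ← intervalIntegral.integral_congr_ae (he.mono fun s hs _ => hs),
    intervalIntegral.integral_congr fun s _ => hc s, hc t]
  simp

end

end Biorthogonal

/-! ### The projector at a point -/

section Projector

variable {X Y : Type*} [NormedAddCommGroup X] [InnerProductSpace ℂ X]
  [NormedAddCommGroup Y] [InnerProductSpace ℂ Y]

theorem HasPairing.zero (ψ : ℝ → Y) (t : ℝ) : HasPairing ψ t 0 0 := by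
  simp [HasPairing]

theorem HasPairing.sum {κ : Type*} {ψ : ℝ → Y} {t : ℝ} (s : Finset κ) {y : κ → Y} {c : κ → ℂ}
    (h : ∀ i ∈ s, HasPairing ψ t (y i) (c i)) :
    HasPairing ψ t (∑ i ∈ s, y i) (∑ i ∈ s, c i) := by
  classical
  induction s using Finset.induction_on with
  | empty => simpa using HasPairing.zero ψ t
  | insert a s ha ih =>
    rw [Finset.sum_insert ha, Finset.sum_insert ha]
    exact (h a (by simp)).add (ih fun i hi => h i (by simp [hi]))

/-- If the means of `ψ` are bounded near `t`, the pairings with `ψ(t)` exist on all of `Y` as soon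
as they exist on a dense subspace. -/
theorem exists_hasPairing_of_bounded {ι : X →L[ℂ] Y} (hι : DenseRange ι) {ψ : ℝ → Y} {t C : ℝ}
    (hC : ∀ᶠ h in 𝓝[>] (0 : ℝ), ‖mean ψ h t‖ ≤ C)
    (hx : ∀ x : X, ∃ c, HasPairing ψ t (ι x) c) (y : Y) : ∃ c, HasPairing ψ t y c := by
  refine (cauchy_map_iff_exists_tendsto).1 (Metric.cauchy_iff.2 ⟨inferInstance, fun ε hε => ?_⟩)
  have hC' : 0 < |C| + 1 := by positivity
  obtain ⟨x, hxy⟩ := hι.exists_dist_lt y (show 0 < ε / 4 / (|C| + 1) by positivity)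
  obtain ⟨c, hc⟩ := hx x
  refine ⟨Metric.ball c (ε / 2), ?_, fun a ha b hb => ?_⟩
  · have h1 : ∀ᶠ h in 𝓝[>] (0 : ℝ), dist (inner ℂ (mean ψ h t) (ι x)) c < ε / 4 :=
      Metric.tendsto_nhds.1 hc _ (by positivity)
    rw [mem_map]
    filter_upwards [h1, hC] with h h1 h2
    have h3 : dist (inner ℂ (mean ψ h t) y) (inner ℂ (mean ψ h t) (ι x)) ≤ ε / 4 := by
      rw [dist_eq_norm, ← inner_sub_right]
      refine (norm_inner_le_norm _ _).trans ?_
      rw [dist_eq_norm, lt_div_iff₀ hC'] at hxy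
      nlinarith [norm_nonneg (y - ι x), le_abs_self C, norm_nonneg (mean ψ h t)]
    have := dist_triangle (inner ℂ (mean ψ h t) y) (inner ℂ (mean ψ h t) (ι x)) c
    show dist _ _ < _
    linarith
  · have := dist_triangle_right a b c
    have h1 : dist a c < ε / 2 := ha
    have h2 : dist b c < ε / 2 := hb
    linarith

theorem HasPairing.norm_le {ψ : ℝ → Y} {t C : ℝ} {y : Y} {c : ℂ} (h : HasPairing ψ t y c)
    (hC : ∀ᶠ h in 𝓝[>] (0 : ℝ), ‖mean ψ h t‖ ≤ C) : ‖c‖ ≤ C * ‖y‖ := by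
  refine le_of_tendsto (Tendsto.norm h) (hC.mono fun r hr => ?_)
  exact (norm_inner_le_norm _ _).trans (mul_le_mul_of_nonneg_right hr (norm_nonneg _))

variable {N : ℕ} {J : Fin N → ℕ} {mult : (k : Fin N) → Fin (J k) → ℕ} {ι : X →L[ℂ] Y}
  {φ : (k : Fin N) → Fin (J k) → ℕ → ℝ → X} {ψ : (k : Fin N) → Fin (J k) → ℕ → ℝ → Y}

/-- Biorthogonality recovers the coefficients of a combination of the `φ` by pairing with
the `ψ`. -/
theorem hasPairing_chainSum {t : ℝ} {V : (k : Fin N) → Fin (J k) → ℕ → Y}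
    (hV : ∀ (k K : Fin N) (j : Fin (J k)) (j' : Fin (J K)) (m m' : ℕ),
      m < mult k j → m' < mult K j' → HasPairing (ψ K j' m') t (V k j (mult k j - 1 - m))
        (if (⟨k, j, m⟩ : (k : Fin N) × Fin (J k) × ℕ) = ⟨K, j', m'⟩ then 1 else 0))
    (c : (k : Fin N) → Fin (J k) → ℕ → ℂ) {K : Fin N} {j' : Fin (J K)} {m' : ℕ}
    (hm' : m' < mult K j') : HasPairing (ψ K j' m') t (chainSum mult c V) (c K j' m') := by
  have h : HasPairing (ψ K j' m') t (chainSum mult c V)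
      (∑ k, ∑ j, ∑ m ∈ Finset.range (mult k j), c k j m *
        (if (⟨k, j, m⟩ : (k : Fin N) × Fin (J k) × ℕ) = ⟨K, j', m'⟩ then 1 else 0)) :=
    HasPairing.sum _ fun k _ => HasPairing.sum _ fun j _ => HasPairing.sum _ fun m hm =>
      (hV k K j j' m m' (Finset.mem_range.1 hm) hm').smul _
  convert h using 1
  rw [Finset.sum_eq_single K, Finset.sum_eq_single j', Finset.sum_eq_single m']
  · simp
  · intro m _ hne
    simp [hne]
  · intro hn
    exact absurd (Finset.mem_range.2 hm') hn
  · intro j _ hne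
    exact Finset.sum_eq_zero fun m _ => by simp [hne]
  · intro hn
    exact absurd (Finset.mem_univ _) hn
  · intro k _ hne
    exact Finset.sum_eq_zero fun j _ => Finset.sum_eq_zero fun m _ => by simp [hne]
  · intro hn
    exact absurd (Finset.mem_univ _) hn

theorem mem_projAt_domain {t : ℝ} {y : Y} : y ∈ (projAt mult ι φ ψ t).domain ↔
    ∀ k j m, m < mult k j → ∃ c, HasPairing (ψ k j m) t y c := Iff.rfl

theorem projAt_apply {t : ℝ} (y : (projAt mult ι φ ψ t).domain) :
    projAt mult ι φ ψ t y = chainSum mult (fun k j m => pairing (ψ k j m) t (y : Y))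
      fun k j m => valueAt (fun s => ι (φ k j m s)) t := rfl

theorem isProjector_projAt {t : ℝ}
    (hV : ∀ (k K : Fin N) (j : Fin (J k)) (j' : Fin (J K)) (m m' : ℕ),
      m < mult k j → m' < mult K j' →
      HasPairing (ψ K j' m') t (valueAt (fun s => ι (φ k j (mult k j - 1 - m) s)) t)
        (if (⟨k, j, m⟩ : (k : Fin N) × Fin (J k) × ℕ) = ⟨K, j', m'⟩ then 1 else 0)) :
    IsProjector (projAt mult ι φ ψ t) := by
  intro y
  have hp : ∀ k j m, m < mult k j →
      HasPairing (ψ k j m) t (projAt mult ι φ ψ t y) (pairing (ψ k j m) t (y : Y)) :=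
    fun k j m hm => by
      rw [projAt_apply]
      exact hasPairing_chainSum (V := fun k j m => valueAt (fun s => ι (φ k j m s)) t) hV
        (fun k j m => pairing (ψ k j m) t (y : Y)) hm
  refine ⟨mem_projAt_domain.2 fun k j m hm => ⟨_, hp k j m hm⟩, ?_⟩
  refine (projAt_apply _).trans (Eq.trans ?_ (projAt_apply y).symm)
  refine Finset.sum_congr rfl fun k _ => Finset.sum_congr rfl fun j _ =>
    Finset.sum_congr rfl fun m hm => ?_
  exact congrArg (· • _) (hp k j m (Finset.mem_range.1 hm)).eq

theorem projAt_of_bounded (hι : DenseRange ι) {t : ℝ}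
    (hx : ∀ x : X, ι x ∈ (projAt mult ι φ ψ t).domain) {C : ℝ}
    (hC : ∀ᶠ h in 𝓝[>] (0 : ℝ), ∀ k j m, m < mult k j → ‖mean (ψ k j m) h t‖ ≤ C) :
    (projAt mult ι φ ψ t).domain = ⊤ ∧ Continuous (projAt mult ι φ ψ t) := by
  have hC' : ∀ k j m, m < mult k j → ∀ᶠ h in 𝓝[>] (0 : ℝ), ‖mean (ψ k j m) h t‖ ≤ C :=
    fun k j m hm => hC.mono fun r hr => hr k j m hm
  refine ⟨eq_top_iff.2 fun y _ k j m hm =>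
    exists_hasPairing_of_bounded hι (hC' k j m hm) (fun x => hx x k j m hm) y, ?_⟩
  set V : (k : Fin N) → Fin (J k) → ℕ → Y := fun k j m => valueAt (fun s => ι (φ k j m s)) t
  refine ((projAt mult ι φ ψ t).toFun.mkContinuous
    (∑ k, ∑ j, ∑ m ∈ Finset.range (mult k j), C * ‖V k j (mult k j - 1 - m)‖) fun y =>
      ?_).continuous
  change ‖chainSum mult (fun k j m => pairing (ψ k j m) t (y : Y)) V‖ ≤ _
  simp only [Finset.sum_mul]
  refine (norm_sum_le _ _).trans (Finset.sum_le_sum fun k _ => ?_)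
  refine (norm_sum_le _ _).trans (Finset.sum_le_sum fun j _ => ?_)
  refine (norm_sum_le _ _).trans (Finset.sum_le_sum fun m hm => ?_)
  obtain ⟨c, hc⟩ := y.2 k j m (Finset.mem_range.1 hm)
  have h1 := hc.norm_le (hC' k j m (Finset.mem_range.1 hm))
  beta_reduce
  rw [norm_smul, hc.eq]
  calc ‖c‖ * ‖V k j (mult k j - 1 - m)‖ ≤ C * ‖(y : Y)‖ * ‖V k j (mult k j - 1 - m)‖ :=
        mul_le_mul_of_nonneg_right h1 (norm_nonneg _)
    _ = C * ‖V k j (mult k j - 1 - m)‖ * ‖y‖ := by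
        rw [Submodule.coe_norm]
        ring

theorem exists_eventually_norm_mean_le {t : ℝ}
    (h : ∀ k j m, m < mult k j → HasValueAt (ψ k j m) t (ψ k j m t)) :
    ∃ C : ℝ, ∀ᶠ r in 𝓝[>] (0 : ℝ), ∀ k j m, m < mult k j → ‖mean (ψ k j m) r t‖ ≤ C := by
  have h1 : ∀ k j m, m < mult k j →
      ∀ᶠ r in 𝓝[>] (0 : ℝ), ‖mean (ψ k j m) r t‖ < ‖ψ k j m t‖ + 1 := fun k j m hm =>
    (Tendsto.norm (h k j m hm)).eventually_lt_const (by linarith)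
  refine ⟨∑ k, ∑ j, ∑ m ∈ Finset.range (mult k j), (‖ψ k j m t‖ + 1), ?_⟩
  have h2 : ∀ᶠ r in 𝓝[>] (0 : ℝ), ∀ k j, ∀ m ∈ Finset.range (mult k j),
      ‖mean (ψ k j m) r t‖ < ‖ψ k j m t‖ + 1 := by
    refine eventually_all.2 fun k => eventually_all.2 fun j => (eventually_all_finset _).2 ?_
    exact fun m hm => h1 k j m (Finset.mem_range.1 hm)
  filter_upwards [h2] with r hr k j m hm
  have hm' := Finset.mem_range.2 hm
  refine (hr k j m hm').le.trans ?_
  refine (Finset.single_le_sum (f := fun m => ‖ψ k j m t‖ + 1) (fun _ _ => by positivity) hm').trans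
    ?_
  refine (Finset.single_le_sum
    (f := fun j => ∑ m ∈ Finset.range (mult k j), (‖ψ k j m t‖ + 1))
    (fun _ _ => Finset.sum_nonneg fun _ _ => by positivity) (Finset.mem_univ j)).trans ?_
  exact Finset.single_le_sum
    (f := fun k => ∑ j, ∑ m ∈ Finset.range (mult k j), (‖ψ k j m t‖ + 1))
    (fun _ _ => Finset.sum_nonneg fun _ _ => Finset.sum_nonneg fun _ _ => by positivity)
    (Finset.mem_univ k)

/-! ### The projector and the operator `𝓛` -/

theorem map_chainSum {E F : Type*} [AddCommGroup E] [Module ℂ E] [AddCommGroup F] [Module ℂ F]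
    (T : E →ₗ[ℂ] F) (c : (k : Fin N) → Fin (J k) → ℕ → ℂ)
    (Φ : (k : Fin N) → Fin (J k) → ℕ → E) :
    T (chainSum mult c Φ) = chainSum mult c fun k j m => T (Φ k j m) := by
  simp only [chainSum, map_sum, map_smul]

theorem chainSum_congr {E : Type*} [AddCommGroup E] [Module ℂ E]
    {c d : (k : Fin N) → Fin (J k) → ℕ → ℂ} {Φ Θ : (k : Fin N) → Fin (J k) → ℕ → E}
    (h : ∀ k j m, m < mult k j →
      c k j m = d k j m ∧ Φ k j (mult k j - 1 - m) = Θ k j (mult k j - 1 - m)) :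
    chainSum mult c Φ = chainSum mult d Θ :=
  Finset.sum_congr rfl fun k _ => Finset.sum_congr rfl fun j _ =>
    Finset.sum_congr rfl fun m hm => by
    rw [(h k j m (Finset.mem_range.1 hm)).1, (h k j m (Finset.mem_range.1 hm)).2]

theorem chainSum_add {E : Type*} [AddCommGroup E] [Module ℂ E]
    (c : (k : Fin N) → Fin (J k) → ℕ → ℂ) (Φ Θ : (k : Fin N) → Fin (J k) → ℕ → E) :
    chainSum mult c Φ + chainSum mult c Θ = chainSum mult c fun k j m => Φ k j m + Θ k j m := by
  simp only [chainSum, smul_add, Finset.sum_add_distrib]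

/-- Shift of the summation index along one chain: `∑ c_m f_{r-2-m} = ∑ c_{m-1} f_{r-1-m}`. -/
theorem sum_smul_shift {E : Type*} [AddCommGroup E] [Module ℂ E] (r : ℕ) (c : ℕ → ℂ) (f : ℕ → E) :
    ∑ m ∈ Finset.range r, c m • (if r - 1 - m = 0 then 0 else f (r - 1 - m - 1))
      = ∑ m ∈ Finset.range r, (if m = 0 then 0 else c (m - 1)) • f (r - 1 - m) := by
  cases r with
  | zero => simp
  | succ r =>
    rw [Finset.sum_range_succ, Finset.sum_range_succ']
    simp only [Nat.add_sub_cancel, Nat.sub_self, if_true, smul_zero, add_zero, zero_smul,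
      Nat.add_eq_zero_iff, one_ne_zero, and_false, if_false]
    refine Finset.sum_congr rfl fun m hm => ?_
    have hm := Finset.mem_range.1 hm
    rw [if_neg (by omega), show r - m - 1 = r - (m + 1) by omega]

/-- The algebra behind `𝓛𝒫u`: with `𝓛Φ_a = -z Φ_a - Φ_{a-1}`, where `Φ_{-1} = 0`, the index shift
moves from `Φ` to the coefficients. -/
theorem chainSum_shift {E : Type*} [AddCommGroup E] [Module ℂ E] (z : Fin N → ℂ)
    (c d : (k : Fin N) → Fin (J k) → ℕ → ℂ) (Φ : (k : Fin N) → Fin (J k) → ℕ → E) :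
    chainSum mult d Φ + chainSum mult c (fun k j a =>
        -(z k • Φ k j a) - if a = 0 then 0 else Φ k j (a - 1))
      = chainSum mult (fun k j m => d k j m - z k * c k j m
          - if m = 0 then 0 else c k j (m - 1)) Φ := by
  simp only [chainSum, ← Finset.sum_add_distrib]
  refine Finset.sum_congr rfl fun k _ => Finset.sum_congr rfl fun j _ => ?_
  simp only [sub_smul, smul_sub, smul_neg, smul_smul, Finset.sum_sub_distrib,
    Finset.sum_add_distrib, Finset.sum_neg_distrib]
  rw [sum_smul_shift, ← add_sub_assoc, ← sub_eq_add_neg]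
  simp only [mul_comm (z k)]

theorem LEq.congr {A : ℝ → X →L[ℂ] Y} {u : ℝ → X} {f g : ℝ → Y} (h : LEq ι A u f)
    (hfg : f =ᵐ[volume] g) : LEq ι A u g := by
  obtain ⟨h1, u', h2, h3⟩ := h
  exact ⟨h1, u', h2, h3.mp (hfg.mono fun t ht h => h.trans ht)⟩

variable [CompleteSpace Y] {A : ℝ → X →L[ℂ] Y} {lam : Fin N → ℂ}

/-- If the coefficients `c` are absolutely continuous with derivatives `c'`, then `𝓛` maps
`∑ c_m φ_{r-1-m}` to `∑ (c_m' - λ c_m - c_{m-1}) φ_{r-1-m}`. -/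
theorem lEq_chainSum (hφ : ∀ k j, IsJordanChain ι A (lam k) (mult k j) (φ k j))
    {c c' : (k : Fin N) → Fin (J k) → ℕ → ℝ → ℂ}
    (hc : ∀ k j m, m < mult k j → IsPrimitive (c k j m) (c' k j m)) :
    LEq ι A (fun t => chainSum mult (fun k j m => c k j m t) fun k j m => φ k j m t)
      (fun t => chainSum mult (fun k j m => c' k j m t - lam k * c k j m t
        - if m = 0 then 0 else c k j (m - 1) t) fun k j m => ι (φ k j m t)) := by
  have hex : ∀ k j a, ∃ φ' : ℝ → Y, a < mult k j → MemXPer ι (φ k j a) φ' ∧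
      ∀ᵐ t, φ' t + A t (φ k j a t)
        = -(lam k • ι (φ k j a t)) - if a = 0 then 0 else ι (φ k j (a - 1) t) := by
    intro k j a
    by_cases ha : a < mult k j
    · obtain ⟨φ', h⟩ := (hφ k j).exists_deriv ha
      exact ⟨φ', fun _ => h⟩
    · exact ⟨0, fun h => absurd h ha⟩
  -- indices beyond the length of a chain carry no condition
  choose φ' hφ' using hex
  set V : (k : Fin N) → Fin (J k) → ℕ → ℝ → Y := fun k j a => valueAt fun s => ι (φ k j a s)
  have hlt : ∀ {k j m}, m < mult k j → mult k j - 1 - m < mult k j := by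
    intro k j m hm
    omega
  have hV : ∀ k j a, a < mult k j → IsPrimitive (V k j a) (φ' k j a) ∧
      V k j a =ᵐ[volume] fun t => ι (φ k j a t) := fun k j a ha => (hφ' k j a ha).1.1.valueAt
  have hVall : ∀ᵐ t, ∀ k j a, a < mult k j → V k j a t = ι (φ k j a t) ∧
      φ' k j a t + A t (φ k j a t)
        = -(lam k • ι (φ k j a t)) - if a = 0 then 0 else ι (φ k j (a - 1) t) := by
    simp only [ae_all_iff]
    exact fun k j a ha => (hV k j a ha).2.and (hφ' k j a ha).2
  have hP : IsPrimitive
      (fun t => chainSum mult (fun k j m => c k j m t) fun k j m => V k j m t)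
      (fun t => ∑ k, ∑ j, ∑ m ∈ Finset.range (mult k j),
        (c' k j m t • V k j (mult k j - 1 - m) t + c k j m t • φ' k j (mult k j - 1 - m) t)) :=
    IsPrimitive.sum _ fun k _ => IsPrimitive.sum _ fun j _ => IsPrimitive.sum _ fun m hm =>
      (hc k j m (Finset.mem_range.1 hm)).smul (hV k j _ (hlt (Finset.mem_range.1 hm))).1
  refine ⟨?_, _, hP.isWeakDerivOn.congr ?_ ae_eq_rfl, ?_⟩
  · exact MemL2Loc.sum _ fun k _ => MemL2Loc.sum _ fun j _ => MemL2Loc.sum _ fun m hm =>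
      ((hφ' k j _ (hlt (Finset.mem_range.1 hm))).1.1.memL2Loc).continuous_smul
        (hc k j m (Finset.mem_range.1 hm)).continuous
  · filter_upwards [hVall] with t ht
    refine Eq.trans ?_ (map_chainSum (ι : X →ₗ[ℂ] Y) _ _).symm
    exact chainSum_congr fun k j m hm => ⟨rfl, (ht k j _ (hlt hm)).1⟩
  · filter_upwards [hVall] with t ht
    have e1 : ∑ k, ∑ j, ∑ m ∈ Finset.range (mult k j),
        (c' k j m t • V k j (mult k j - 1 - m) t + c k j m t • φ' k j (mult k j - 1 - m) t)
        = chainSum mult (fun k j m => c' k j m t) (fun k j m => ι (φ k j m t))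
          + chainSum mult (fun k j m => c k j m t) (fun k j m => φ' k j m t) := by
      simp only [Finset.sum_add_distrib]
      refine congrArg₂ (· + ·) ?_ rfl
      exact chainSum_congr (Φ := fun k j m => V k j m t)
        fun k j m hm => ⟨rfl, (ht k j _ (hlt hm)).1⟩
    have e2 : A t (chainSum mult (fun k j m => c k j m t) fun k j m => φ k j m t)
        = chainSum mult (fun k j m => c k j m t) fun k j m => A t (φ k j m t) :=
      map_chainSum (A t : X →ₗ[ℂ] Y) _ _
    rw [e1, e2, add_assoc, chainSum_add, ← chainSum_shift]
    congr 1
    exact chainSum_congr fun k j m hm => ⟨rfl, (ht k j _ (hlt hm)).2⟩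

end Projector

end Floquet

theorem theorem7
    {X Y : Type*}
    [NormedAddCommGroup X] [InnerProductSpace ℂ X] [CompleteSpace X]
    [NormedAddCommGroup Y] [InnerProductSpace ℂ Y] [CompleteSpace Y]
    -- the compact and dense embedding of `X` into `Y`
    (ι : X →L[ℂ] Y) (hι_inj : Function.Injective ι) (hι_cpt : IsCompactOperator ι)
    (hι_dense : DenseRange ι)
    -- the periodic operator function
    (A : ℝ → X →L[ℂ] Y) (hA_cont : Continuous A) (hA_per : Function.Periodic A 1)
    (hA_est : LocalEstimate ι A) (hA_iso : ∃ z₀ : ℂ, PencilIso ι A z₀)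
    -- the strip, and the eigenvalues in it
    (β₁ β₂ : ℝ) (hβ : β₁ < β₂)
    (hβ₁ : ∀ z : ℂ, z.re = β₁ → z.im ∈ Set.Ico 0 (2 * Real.pi) → ¬ IsEigenvalue ι A z)
    (hβ₂ : ∀ z : ℂ, z.re = β₂ → z.im ∈ Set.Ico 0 (2 * Real.pi) → ¬ IsEigenvalue ι A z)
    (N : ℕ) (lam : Fin N → ℂ) (hlam_inj : Function.Injective lam)
    (hlam : Set.range lam = {z : ℂ | IsEigenvalue ι A z ∧ z.re ∈ Set.Ioo β₁ β₂ ∧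
      z.im ∈ Set.Ico 0 (2 * Real.pi)})
    -- the Jordan chains
    (J : Fin N → ℕ) (mult : (k : Fin N) → Fin (J k) → ℕ)
    (φ : (k : Fin N) → Fin (J k) → ℕ → ℝ → X)
    (hφ : ∀ k, IsCanonicalSystem ι A (lam k) (J k) (mult k) (φ k))
    (ψ : (k : Fin N) → Fin (J k) → ℕ → ℝ → Y)
    (hψ : ∀ k j, IsAdjointChain ι A (lam k) (mult k j) (ψ k j))
    (hφψ : ∀ k (j j' : Fin (J k)) (m : ℕ), m < mult k j' →
      innerPer (fun t => ι (φ k j (mult k j - 1) t)) (ψ k j' m)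
        = if j = j' ∧ m = 0 then 1 else 0) :
    -- for almost every `t`, the pairing with `ψ(t)` is the inner product of `Y`
    (∀ᵐ t, ∀ k j m, m < mult k j → ∀ y : Y, HasPairing (ψ k j m) t y (inner ℂ (ψ k j m t) y)) ∧
    -- every `u ∈ 𝒳_loc` has a value `u(t)` at every `t`, continuous in `t`, in the domain of `𝒫(t)`
    (∀ (u : ℝ → X) (u' : ℝ → Y), MemXLoc ι u u' →
      Continuous (valueAt (fun s => ι (u s))) ∧
      (∀ᵐ t, valueAt (fun s => ι (u s)) t = ι (u t)) ∧
      ∀ t, HasValueAt (fun s => ι (u s)) t (valueAt (fun s => ι (u s)) t) ∧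
        valueAt (fun s => ι (u s)) t ∈ (projAt mult ι φ ψ t).domain) ∧
    -- pointwise biorthogonality
    (∀ (t : ℝ) (k K : Fin N) (j : Fin (J k)) (j' : Fin (J K)) (m m' : ℕ),
      m < mult k j → m' < mult K j' →
      HasPairing (ψ K j' m') t (valueAt (fun s => ι (φ k j (mult k j - 1 - m) s)) t)
        (if (⟨k, j, m⟩ : (k : Fin N) × Fin (J k) × ℕ) = ⟨K, j', m'⟩ then 1 else 0)) ∧
    -- (i)
    (∀ t : ℝ, IsProjector (projAt mult ι φ ψ t) ∧
      (∀ x : X, ι x ∈ (projAt mult ι φ ψ t).domain) ∧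
      ((∃ C : ℝ, ∀ᶠ h in 𝓝[>] (0 : ℝ), ∀ k j m, m < mult k j → ‖mean (ψ k j m) h t‖ ≤ C) →
        (projAt mult ι φ ψ t).domain = ⊤ ∧ Continuous (projAt mult ι φ ψ t))) ∧
    (∀ᵐ t, (projAt mult ι φ ψ t).domain = ⊤ ∧ Continuous (projAt mult ι φ ψ t)) ∧
    -- (ii)
    (∀ (u : ℝ → X) (u' : ℝ → Y), MemXLoc ι u u' →
      LEq ι A (projX mult ι φ ψ u) (projY mult ι φ ψ (fun t => u' t + A t (u t)))) ∧
    -- (iii)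
    (∀ (u : ℝ → X) (u' : ℝ → Y), MemXLoc ι u u' →
      ∃ c' : (k : Fin N) → Fin (J k) → ℕ → ℝ → ℂ,
        (∀ k j m, m < mult k j → Continuous (coeffX ι ψ u k j m) ∧
          IsWeakDerivOn Set.univ (coeffX ι ψ u k j m) (c' k j m)) ∧
        LEq ι A (projX mult ι φ ψ u) (fun t => chainSum mult
          (fun k j m => c' k j m t - lam k * coeffX ι ψ u k j m t
            - if m = 0 then 0 else coeffX ι ψ u k j (m - 1) t)
          (fun k j m => ι (φ k j m t)))) := by
  have hJ : ∀ k j, IsJordanChain ι A (lam k) (mult k j) (φ k j) := fun k => (hφ k).chain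
  have hψY : ∀ k j m, m < mult k j → MemYPer (ψ k j m) := fun k j m hm =>
    ((hψ k j).adjointEq hm).1
  have hval : ∀ᵐ t, ∀ k j m, m < mult k j → HasValueAt (ψ k j m) t (ψ k j m t) := by
    simp only [ae_all_iff]
    exact fun k j m hm => ae_hasValueAt (hψY k j m hm).1.locallyIntegrable
  have hpair : ∀ᵐ t, ∀ k j m, m < mult k j → ∀ y : Y,
      HasPairing (ψ k j m) t y (inner ℂ (ψ k j m t) y) :=
    hval.mono fun t ht k j m hm y => Tendsto.inner (ht k j m hm) tendsto_const_nhds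
  have hdom : ∀ (u : ℝ → X) (u' : ℝ → Y), MemXLoc ι u u' → ∀ t,
      valueAt (fun s => ι (u s)) t ∈ (projAt mult ι φ ψ t).domain := fun u u' hu t =>
    mem_projAt_domain.2 fun k j m hm => ⟨_, (hψ k j).hasPairing hA_cont hA_per hu hm t⟩
  have hbi : ∀ (t : ℝ) (k K : Fin N) (j : Fin (J k)) (j' : Fin (J K)) (m m' : ℕ),
      m < mult k j → m' < mult K j' →
      HasPairing (ψ K j' m') t (valueAt (fun s => ι (φ k j (mult k j - 1 - m) s)) t)
        (if (⟨k, j, m⟩ : (k : Fin N) × Fin (J k) × ℕ) = ⟨K, j', m'⟩ then 1 else 0) := by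
    intro t k K j j' m m' hm hm'
    have ha : mult k j - 1 - m < mult k j := by omega
    obtain ⟨φ', hφ', -⟩ := (hJ k j).exists_deriv ha
    convert (hψ K j').hasPairing hA_cont hA_per hφ'.1 hm' t using 1
    by_cases hk : k = K
    · subst hk
      rw [chain_pairing_shift hA_cont hA_per (hJ k j) (hψ k j') hm hm']
      split_ifs with h1 h2 h2
      · rw [chain_pairing_eq_innerPer hA_cont hA_per (hJ k j) (hψ k j') (by omega) (by omega),
          hφψ k j j' _ (by omega)]
        cases h1
        simp
      · cases h1
        exact absurd le_rfl h2
      · rw [chain_pairing_eq_innerPer hA_cont hA_per (hJ k j) (hψ k j') (by omega) (by omega),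
          hφψ k j j' _ (by omega), if_neg]
        rintro ⟨rfl, h3⟩
        exact h1 (by rw [show m = m' by omega])
      · rfl
    · have hin : ∀ k, (lam k).im ∈ Set.Ico 0 (2 * Real.pi) := fun k =>
        (hlam.subset (Set.mem_range_self k)).2.2
      rw [chain_pairing_eq_zero hA_cont hA_per (hJ k j) (hψ K j')
        (exp_sub_ne_one (fun h => hk (hlam_inj h).symm) (hin K) (hin k)) ha hm', if_neg]
      intro h
      exact hk (congrArg Sigma.fst h)
  -- a constant function `u = x` belongs to `𝒳_loc`, so the domain contains its value
  have hX : ∀ (t : ℝ) (x : X), ι x ∈ (projAt mult ι φ ψ t).domain := by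
    intro t x
    have hx : MemXLoc ι (fun _ => x) (fun _ => 0) :=
      memXLoc_of_isPrimitive (fun a b => memLp_const x) (fun a b => memLp_const 0)
        (isPrimitive_const (ι x)) ae_eq_rfl
    have := hdom _ _ hx t
    rwa [valueAt_of_ae_eq continuous_const (ae_eq_refl fun _ : ℝ => ι x)] at this
  have hc : ∀ (u : ℝ → X) (u' : ℝ → Y), MemXLoc ι u u' → ∀ k j m, m < mult k j →
      IsPrimitive (coeffX ι ψ u k j m) (fun t => inner ℂ (ψ k j m t) (u' t + A t (u t))
        + lam k * coeffX ι ψ u k j m t + if m = 0 then 0 else coeffX ι ψ u k j (m - 1) t) :=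
    fun u u' hu k j m hm => (hψ k j).isPrimitive_coeff hA_cont hA_per hu hm
  refine ⟨hpair, fun u u' hu => ⟨hu.valueAt.1.continuous, hu.valueAt.2,
    fun t => ⟨hu.hasValueAt t, hdom u u' hu t⟩⟩, hbi,
    fun t => ⟨isProjector_projAt (hbi t), hX t, ?_⟩,
    ?_, ?_, ?_⟩
  · rintro ⟨C, hC⟩
    exact projAt_of_bounded hι_dense (hX t) hC
  · filter_upwards [hval] with t ht
    obtain ⟨C, hC⟩ := exists_eventually_norm_mean_le ht
    exact projAt_of_bounded hι_dense (hX t) hC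
  · intro u u' hu
    -- the `m`-th coefficient is `(𝓛u, ψ_m)` almost everywhere
    refine (lEq_chainSum hJ (hc u u' hu)).congr ?_
    have hφv : ∀ᵐ t, ∀ k j m, m < mult k j →
        valueAt (fun s => ι (φ k j m s)) t = ι (φ k j m t) := by
      simp only [ae_all_iff]
      intro k j m hm
      obtain ⟨φ', hφ', -⟩ := (hJ k j).exists_deriv hm
      exact hφ'.1.valueAt.2
    filter_upwards [hpair, hφv] with t ht1 ht2
    refine chainSum_congr fun k j m hm => ⟨?_, (ht2 k j _ (by omega)).symm⟩
    rw [coeff, (ht1 k j m hm _).eq]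
    ring
  · intro u u' hu
    exact ⟨_, fun k j m hm => ⟨(hc u u' hu k j m hm).continuous,
        (hc u u' hu k j m hm).isWeakDerivOn⟩,
      lEq_chainSum hJ (hc u u' hu)⟩
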